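/- Let $k,m,n$ be positive integers with $1\le k<\min\{m,n\}$, let $\mathcal H_m=\mathbb C^m$, $\mathcal H_n=\mathbb C^n$ with their standard bases, and let $\mathcal L(\mathcal H)$ denote the linear operators on $\mathcal H$. The Schmidt rank $SR(v)$ of $v\in\mathcal H_m\otimes\mathcal H_n$ is the rank of the $m\times n$ matrix $A_v$ associated with $v$ by the linear isomorphism determined by $a\otimes b\mapsto ab^T$ (equivalently, the number of nonzero terms in the Schmidt decomposition of $v$). For $X\in\mathcal L(\mathcal H_m)\otimes\mathcal L(\mathcal H_n)$ put $$\|X\|_{S(k)}:=\sup\big\{|\langle w|X|y\rangle| : \|w\|=\|y\|=1,\ SR(w)\le k,\ SR(y)\le k\big\}.$$ Let $\Phi:\mathcal L(\mathcal H_m)\otimes\mathcal L(\mathcal H_n)\to\mathcal L(\mathcal H_m)\otimes\mathcal L(\mathcal H_n)$ be a complex-linear map. Then $\|\Phi(X)\|_{S(k)}=\|X\|_{S(k)}$ for all $X\in\mathcal L(\mathcal H_m)\otimes\mathcal L(\mathcal H_n)$ if and only if $\Phi$ can be written as a composition of one or more of the following maps: (a) $X\mapsto UXV$, where each of $U$ and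 $V$ is of the form $W\otimes Y$, or, if $n=m$, of the form $S(W\otimes Y)$, with unitaries $W\in\mathcal L(\mathcal H_m)$ and $Y\in\mathcal L(\mathcal H_n)$, where $S$ is the swap operator $S(a\otimes b)=b\otimes a$; (b) the transpose map $X\mapsto X^T$; (c) if $k=1$, the partial transpose map $\mathrm{id}_m\otimes T$, where $T$ is the transpose map on $\mathcal L(\mathcal H_n)$. -/

import Mathlib

open scoped Kronecker

namespace SchmidtIsometry

noncomputable section

/-- The bipartite Hilbert space `H_m ⊗ H_n`, in the coordinates of the standard product basis. -/
abbrev BipartiteVec (m n : ℕ) : Type := EuclideanSpace ℂ (Fin m × Fin n)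

/-- The operators `L(H_m) ⊗ L(H_n)` on `H_m ⊗ H_n`, as matrices in the standard product basis. -/
abbrev BipartiteOp (m n : ℕ) : Type := Matrix (Fin m × Fin n) (Fin m × Fin n) ℂ

/-- The image `A_v` of `v` under the isomorphism `H_m ⊗ H_n ≃ L(H_n, H_m)` that is linear and sends
`a ⊗ b` to `a bᵀ`. -/
def vecToOp {m n : ℕ} (v : BipartiteVec m n) : Matrix (Fin m) (Fin n) ℂ :=
  Matrix.of fun i j => v (i, j)

/-- The Schmidt rank of a bipartite vector: the rank of its associated operator, that is, the
number of nonzero coefficients in its Schmidt decomposition. -/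
def schmidtRank {m n : ℕ} (v : BipartiteVec m n) : ℕ := (vecToOp v).rank

/-- `⟨w| X |y⟩`. -/
def braOpKet {m n : ℕ} (w : BipartiteVec m n) (X : BipartiteOp m n) (y : BipartiteVec m n) : ℂ :=
  inner ℂ w (Matrix.toEuclideanLin X y)

/-- The norm `‖X‖_{S(k)}`: the supremum of `|⟨w|X|y⟩|` over unit vectors `w`, `y` of Schmidt rank
at most `k`. -/
def schmidtOpNorm {m n : ℕ} (k : ℕ) (X : BipartiteOp m n) : ℝ :=
  sSup {r : ℝ | ∃ w y : BipartiteVec m n, ‖w‖ = 1 ∧ ‖y‖ = 1 ∧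
    schmidtRank w ≤ k ∧ schmidtRank y ≤ k ∧ r = ‖braOpKet w X y‖}

/-- The swap operator on `H_m ⊗ H_n` when `n = m`; it sends `a ⊗ b` to `b ⊗ a`. -/
def swapOp {m n : ℕ} (h : n = m) : BipartiteOp m n :=
  Matrix.of fun p q => if p.1 = Fin.cast h q.2 ∧ p.2 = Fin.cast h.symm q.1 then 1 else 0

theorem swapOp_mulVec_tensor {n : ℕ} (a b : Fin n → ℂ) :
    (swapOp (rfl : n = n)).mulVec (fun p => a p.1 * b p.2) = fun p => b p.1 * a p.2 := by
  funext p
  have key : ∀ q : Fin n × Fin n,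
      swapOp (rfl : n = n) p q * (a q.1 * b q.2) = if q = p.swap then b p.1 * a p.2 else 0 := by
    rintro ⟨i, j⟩
    obtain ⟨s, t⟩ := p
    by_cases h : s = j ∧ t = i
    · obtain ⟨rfl, rfl⟩ := h
      simp [swapOp, mul_comm]
    · have h' : ¬ (i = t ∧ j = s) := fun e => h ⟨e.2.symm, e.1.symm⟩
      simp [swapOp, h, h']
  simp [Matrix.mulVec, dotProduct, key]

/-- `U` is a local unitary `W ⊗ Y`, or `n = m` and `U` is a local unitary followed by the swap. -/
def IsLocalUnitary {m n : ℕ} (U : BipartiteOp m n) : Prop :=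
  (∃ W ∈ Matrix.unitaryGroup (Fin m) ℂ, ∃ Y ∈ Matrix.unitaryGroup (Fin n) ℂ, U = W ⊗ₖ Y) ∨
  (∃ h : n = m, ∃ W ∈ Matrix.unitaryGroup (Fin m) ℂ, ∃ Y ∈ Matrix.unitaryGroup (Fin n) ℂ,
    U = swapOp h * (W ⊗ₖ Y))

/-- The linear map `X ↦ U X V`. -/
def mulLeftRight {m n : ℕ} (U V : BipartiteOp m n) : Module.End ℂ (BipartiteOp m n) where
  toFun X := U * X * V
  map_add' X Y := by rw [mul_add, add_mul]
  map_smul' c X := by simp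

/-- The transpose map `T` on operators. -/
def transposeMap (m n : ℕ) : Module.End ℂ (BipartiteOp m n) where
  toFun X := X.transpose
  map_add' X Y := Matrix.transpose_add X Y
  map_smul' c X := Matrix.transpose_smul c X

/-- The partial transpose map `id_m ⊗ T`. -/
def partialTransposeMap (m n : ℕ) : Module.End ℂ (BipartiteOp m n) where
  toFun X := Matrix.of fun p q => X (p.1, q.2) (q.1, p.2)
  map_add' _ _ := rfl
  map_smul' _ _ := rfl

theorem partialTransposeMap_kronecker {m n : ℕ} (A : Matrix (Fin m) (Fin m) ℂ)
    (B : Matrix (Fin n) (Fin n) ℂ) :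
    partialTransposeMap m n (A ⊗ₖ B) = A ⊗ₖ B.transpose := rfl

/-- The elementary maps: `X ↦ U X V` with `U`, `V` local unitaries (each possibly followed by the
swap), the transpose, and, only for `k = 1`, the partial transpose. -/
inductive IsElementary (k m n : ℕ) : Module.End ℂ (BipartiteOp m n) → Prop
  | mul (U V : BipartiteOp m n) (hU : IsLocalUnitary U) (hV : IsLocalUnitary V) :
      IsElementary k m n (mulLeftRight U V)
  | transpose : IsElementary k m n (transposeMap m n)
  | partialTranspose (hk : k = 1) : IsElementary k m n (partialTransposeMap m n)

/-- `Φ` is a composition of one or more elementary maps. -/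
def IsCompositionOfElementary (k m n : ℕ) (Φ : Module.End ℂ (BipartiteOp m n)) : Prop :=
  Φ ∈ Subsemigroup.closure {Ψ | IsElementary k m n Ψ}

end

end SchmidtIsometry

/-! The norm of `X` is the supremum of `|⟨z, X⟩|`, in the Hilbert–Schmidt inner product, over the
compact set E of unit operators `|w⟩⟨y|` with both Schmidt ranks at most `k`. All elements of E have
the same Hilbert norm, so equality in Cauchy–Schwarz recovers E from its support function: the
adjoint `Ψ` of an isometry `Φ` maps E onto E (`subset_image_of_sSup_inner_eq`,
`exists_adjoint_of_isometry`).

Next the bound is lowered from `k` to 1. The directions of lines through `|x⟩⟨y|` that stay in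
`lowOp` span the full tangent space of the rank-one operators exactly when neither Schmidt rank is
maximal. This criterion is linear-algebraic, hence invariant under `Ψ` (`mem_lowOp_iff_finrank`,
`map_mem_lowOp_of_le`); it needs `k < min m n`.

So `Ψ` preserves product tensors with four factors, two in the ket and two in the bra. Two product
tensors add up to a product only if they agree, up to scalars, in all factors but one. Hence `Ψ`
permutes the four directions at a product tensor `e`, respecting dimensions. For `k ≥ 2` the two ket
factors must stay on one side (`HasDirections.fst_eq`). The permutations left over are undone by
transposition, swaps when `m = n`, and partial transposition when `k = 1`. After that, `Ψ` acts on
each line through `e` by a unitary; once these are undone too, it fixes the star of `e`, and then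
everything (`IsSegre.map_eq_self_of_fixesStar`). Thus `G * Ψ = 1` for a composition `G` of
elementary maps, and since `G` is unitary, `Φ = Ψ* = G`.

Conversely, elementary maps are Hilbert–Schmidt unitaries that permute E. -/

namespace SchmidtIsometry

/-! ### Rigidity of linear maps that preserve product tensors. -/

section Segre

open Function

variable {ι : Type*} [Fintype ι] [DecidableEq ι] {V : ι → Type*} [∀ i, AddCommGroup (V i)]
  [∀ i, Module ℂ (V i)] {M : Type*} [AddCommGroup M] [Module ℂ M]

/-- A multilinear map whose values add up to a value only along a single factor, as is the case
for the map sending a family of vectors to its tensor product. -/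
structure IsSegre (τ : MultilinearMap ℂ V M) : Prop where
  ne_zero : ∀ v, (∀ i, v i ≠ 0) → τ v ≠ 0
  exists_of_add : ∀ v w u, (∀ i, v i ≠ 0) → (∀ i, w i ≠ 0) → τ v + τ w = τ u →
    ∃ j, ∀ l ≠ j, ∃ c : ℂ, w l = c • v l

variable {τ : MultilinearMap ℂ V M}

theorem exists_smul_of_parallel {v w : ∀ i, V i} {j : ι} (h : ∀ l ≠ j, ∃ c : ℂ, w l = c • v l) :
    ∃ C : ℂ, ∀ s, τ (update w j s) = C • τ (update v j s) := by
  classical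
  choose! c hc using h
  refine ⟨∏ l, update c j 1 l, fun s => ?_⟩
  rw [← τ.map_smul_univ]
  congr 1
  funext l
  rcases eq_or_ne l j with rfl | hl
  · simp
  · simp [hl, hc l hl]

theorem exists_smul_of_parallel' {v w : ∀ i, V i} {j : ι} (h : ∀ l ≠ j, ∃ c : ℂ, w l = c • v l) :
    ∃ C : ℂ, τ w = τ (update v j (C • w j)) := by
  obtain ⟨C, hC⟩ := exists_smul_of_parallel (τ := τ) h
  refine ⟨C, ?_⟩
  have := hC (w j)
  rw [update_eq_self] at this
  rw [this, τ.map_update_smul]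

omit [Fintype ι] [DecidableEq ι] in
theorem ne_zero_of_map_ne_zero {v : ∀ i, V i} (h : τ v ≠ 0) (i : ι) : v i ≠ 0 :=
  fun hi => h (τ.map_coord_zero i hi)

omit [Fintype ι] [∀ i, Module ℂ (V i)] in
theorem update_ne_zero {v : ∀ i, V i} (hv : ∀ i, v i ≠ 0) {j : ι} {s : V j} (hs : s ≠ 0) (i : ι) :
    update v j s i ≠ 0 := by
  rcases eq_or_ne i j with rfl | h
  · simpa using hs
  · simpa [h] using hv i

namespace IsSegre

variable (hτ : IsSegre τ)
include hτ

omit [Fintype ι] in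
theorem eq_zero_of_update {v : ∀ i, V i} (hv : ∀ i, v i ≠ 0) {j : ι} {s : V j}
    (h : τ (update v j s) = 0) : s = 0 := by
  by_contra hs
  exact hτ.ne_zero _ (update_ne_zero hv hs) h

/-- Here `τ v + τ w = (1 + a) • τ v` is again a product, so the additivity property gives all
factors but one; the last one follows by cancelling the others. -/
theorem parallel_of_eq_smul {v w : ∀ i, V i} (hv : ∀ i, v i ≠ 0) (hw : ∀ i, w i ≠ 0) {a : ℂ}
    (h : τ w = a • τ v) (i : ι) : ∃ c : ℂ, w i = c • v i := by
  obtain ⟨j, hj⟩ := hτ.exists_of_add v w (update v i ((1 + a) • v i)) hv hw (by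
    rw [τ.map_update_smul, update_eq_self, h, add_smul, one_smul])
  rcases eq_or_ne i j with rfl | hij
  · obtain ⟨C, hC⟩ := exists_smul_of_parallel (τ := τ) hj
    have h1 := hC (w i)
    rw [update_eq_self, h] at h1
    have hC0 : C ≠ 0 := by
      rintro rfl
      rw [zero_smul, ← h] at h1
      exact hτ.ne_zero w hw h1
    have h2 : τ (update v i (C • w i - a • v i)) = 0 := by
      rw [τ.map_update_sub, τ.map_update_smul, τ.map_update_smul, update_eq_self, h1, sub_self]
    have h3 := sub_eq_zero.1 (hτ.eq_zero_of_update hv h2)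
    exact ⟨C⁻¹ * a, by rw [mul_smul, ← h3, smul_smul, inv_mul_cancel₀ hC0, one_smul]⟩
  · exact hj i hij

end IsSegre

/-- `Ψ` fixes all the values of `τ` at families that differ from `v` in at most one place. -/
def FixesStar (τ : MultilinearMap ℂ V M) (Ψ : M →ₗ[ℂ] M) (v : ∀ i, V i) : Prop :=
  ∀ i u, Ψ (τ (update v i u)) = τ (update v i u)

theorem parallel_symm {W : Type*} [AddCommGroup W] [Module ℂ W] {a b : W} (ha : a ≠ 0) {c : ℂ}
    (h : a = c • b) : ∃ c' : ℂ, b = c' • a := by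
  have hc : c ≠ 0 := by
    rintro rfl
    exact ha (by simpa using h)
  exact ⟨c⁻¹, by rw [h, smul_smul, inv_mul_cancel₀ hc, one_smul]⟩

theorem parallel_trans {W : Type*} [AddCommGroup W] [Module ℂ W] {a b r : W} (hr : r ≠ 0)
    (ha : ∃ c : ℂ, r = c • a) (hb : ∃ c : ℂ, r = c • b) : ∃ c : ℂ, b = c • a := by
  obtain ⟨c, hc⟩ := ha
  obtain ⟨d, hd⟩ := hb
  obtain ⟨d', hd'⟩ := parallel_symm hr hd
  exact ⟨d' * c, by rw [hd', hc, smul_smul]⟩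

namespace IsSegre

variable (hτ : IsSegre τ) {Ψ : M →ₗ[ℂ] M} (hinj : Injective Ψ)
  (hmap : ∀ v, ∃ r, Ψ (τ v) = τ r)
include hτ hinj hmap

/-- The tensor differs from `v` in two places. Adding to it either neighbour with one change gives a
product, and both neighbours are fixed, so the image `r` is parallel to one neighbour off a place
`j` and to the other off a place `j'`. Since `s` and `u` are new directions, `{j, j'} = {i, l}`. One
assignment makes `r` parallel to the tensor itself; the other makes it parallel to `v`, against
injectivity. -/
theorem exists_eq_smul_of_fixesStar {v : ∀ i, V i} (hv : ∀ i, v i ≠ 0) (hfix : FixesStar τ Ψ v)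
    {l i : ι} (hil : i ≠ l) {s : V l} {u : V i} (hs : ¬∃ c : ℂ, s = c • v l)
    (hu : ¬∃ c : ℂ, u = c • v i) :
    ∃ c : ℂ, Ψ (τ (update (update v l s) i u)) = c • τ (update (update v l s) i u) := by
  have hs0 : s ≠ 0 := fun h => hs ⟨0, by simpa using h⟩
  have hu0 : u ≠ 0 := fun h => hu ⟨0, by simpa using h⟩
  set q := update (update v l s) i u with hq
  have hq0 : ∀ i, q i ≠ 0 := update_ne_zero (update_ne_zero hv hs0) hu0
  obtain ⟨r, hr⟩ := hmap q
  have hr0 : ∀ i, r i ≠ 0 := ne_zero_of_map_ne_zero (τ := τ) (by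
    rw [← hr]
    exact fun h => hτ.ne_zero q hq0 (hinj (by rw [h, map_zero])))
  have hw0 := update_ne_zero hv hs0
  have hz0 := update_ne_zero hv hu0
  obtain ⟨j, hj⟩ : ∃ j, ∀ k ≠ j, ∃ c : ℂ, r k = c • update v l s k := by
    obtain ⟨t, ht⟩ := hmap (update (update v l s) i (v i + u))
    refine hτ.exists_of_add _ _ t hw0 hr0 ?_
    rw [← ht, ← hr, τ.map_update_add, map_add, ← hq]
    congr 1
    have : update (update v l s) i (v i) = update v l s := by
      rw [update_comm hil.symm, update_eq_self]
    rw [this, hfix]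
  obtain ⟨j', hj'⟩ : ∃ j, ∀ k ≠ j, ∃ c : ℂ, r k = c • update v i u k := by
    obtain ⟨t, ht⟩ := hmap (update (update v i u) l (v l + s))
    refine hτ.exists_of_add _ _ t hz0 hr0 ?_
    rw [← ht, ← hr, τ.map_update_add, map_add, hq, update_comm hil.symm s u v]
    congr 1
    have : update (update v i u) l (v l) = update v i u := by
      rw [update_comm hil, update_eq_self]
    rw [this, hfix]
  have hji : j ≠ i → j' = i := by
    intro h
    by_contra h'
    have h1 := hj i h.symm
    have h2 := hj' i (Ne.symm h')
    rw [update_of_ne hil] at h1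
    rw [update_self] at h2
    exact hu (parallel_trans (hr0 i) h1 h2)
  have hjl : j ≠ l → j' = l := by
    intro h
    by_contra h'
    have h1 := hj l h.symm
    have h2 := hj' l (Ne.symm h')
    rw [update_self] at h1
    rw [update_of_ne hil.symm] at h2
    exact hs (parallel_trans (hr0 l) h2 h1)
  have hothers : ∀ k, k ≠ i → k ≠ l → ∃ c : ℂ, r k = c • v k := by
    intro k hki hkl
    by_cases hkj : k = j
    · have := hj' k (by
        rintro rfl
        subst hkj
        exact hki (hji hki))
      rwa [update_of_ne hki] at this
    · have := hj k hkj
      rwa [update_of_ne hkl] at this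
  rcases eq_or_ne j i with rfl | hjni
  · have hj'l := hjl hil
    subst hj'l
    have hpar : ∀ k ≠ j, ∃ c : ℂ, r k = c • q k := by
      intro k hk
      rw [hq, update_of_ne hk]
      exact hj k hk
    have hpar' : ∃ c : ℂ, r j = c • u := by simpa using hj' j hil
    obtain ⟨C, hC⟩ := exists_smul_of_parallel (τ := τ) hpar
    obtain ⟨c, hc⟩ := hpar'
    refine ⟨C * c, ?_⟩
    have h1 := hC (r j)
    rw [update_eq_self, hc, τ.map_update_smul, smul_smul] at h1
    rw [hr, h1, hq, update_idem]
  · have hj'i := hji hjni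
    subst hj'i
    by_cases hjl' : j = l
    · subst hjl'
      have hpar : ∀ k, ∃ c : ℂ, r k = c • v k := by
        intro k
        rcases eq_or_ne k j' with rfl | h1
        · simpa [hil] using hj k hil
        · rcases eq_or_ne k j with rfl | h2
          · simpa [h1] using hj' k h1
          · exact hothers k h1 h2
      choose c hc using hpar
      have h3 : τ r = (∏ k, c k) • τ v := by
        rw [← τ.map_smul_univ]
        congr 1
        funext k
        exact hc k
      have h4 : τ q = (∏ k, c k) • τ v := by
        apply hinj
        rw [hr, h3, map_smul]
        have := hfix j' (v j')
        rw [update_eq_self] at this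
        rw [this]
      have h5 := hτ.parallel_of_eq_smul hv hq0 h4 j'
      rw [hq, update_self] at h5
      exact absurd h5 hu
    · exact absurd (hjl hjl') hil

/-- Tensors with two changed places are eigenvectors by the previous lemma; comparing the
eigenvalues for `u` and for `u + v i` forces both to be 1, because `v i` carries eigenvalue 1 and is
independent of `u`. -/
theorem fixesStar_update {v : ∀ i, V i} (hv : ∀ i, v i ≠ 0) (hfix : FixesStar τ Ψ v) {l : ι}
    {s : V l} (hs0 : s ≠ 0) : FixesStar τ Ψ (update v l s) := by
  intro i u
  rcases eq_or_ne i l with rfl | hil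
  · rw [update_idem]
    exact hfix i u
  by_cases hs : ∃ c : ℂ, s = c • v l
  · obtain ⟨c, rfl⟩ := hs
    rw [update_comm hil.symm, τ.map_update_smul, map_smul,
      show update (update v i u) l (v l) = update v i u by
        rw [update_comm hil, update_eq_self], hfix]
  have hw : update (update v l s) i (v i) = update v l s := by
    rw [update_comm hil.symm, update_eq_self]
  by_cases hu : ∃ c : ℂ, u = c • v i
  · obtain ⟨c, rfl⟩ := hu
    rw [τ.map_update_smul, map_smul, hw, hfix]
  have hu' : ¬∃ c : ℂ, u + v i = c • v i := by
    rintro ⟨c, hc⟩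
    exact hu ⟨c - 1, by rw [sub_smul, one_smul, ← hc, add_sub_cancel_right]⟩
  obtain ⟨c, hc⟩ := hτ.exists_eq_smul_of_fixesStar hinj hmap hv hfix hil hs hu
  obtain ⟨c', hc'⟩ := hτ.exists_eq_smul_of_fixesStar hinj hmap hv hfix hil hs hu'
  rw [τ.map_update_add, map_add, hc, hw, hfix, smul_add] at hc'
  have h0 : τ (update (update v l s) i ((c - c') • u + (1 - c') • v i)) = 0 := by
    rw [τ.map_update_add, τ.map_update_smul, τ.map_update_smul, hw, sub_smul, sub_smul, one_smul]
    rw [← sub_eq_zero.2 hc']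
    module
  have h1 := hτ.eq_zero_of_update (update_ne_zero hv hs0) h0
  have hcc : c - c' = 0 := by
    by_contra hne
    refine hu ⟨-((c - c')⁻¹ * (1 - c')), ?_⟩
    rw [neg_smul, mul_smul, eq_neg_iff_add_eq_zero]
    have h2 : (c - c')⁻¹ • ((c - c') • u + (1 - c') • v i) = 0 := by rw [h1, smul_zero]
    rwa [smul_add, smul_smul, inv_mul_cancel₀ hne, one_smul] at h2
  rw [hcc, zero_smul, zero_add] at h1
  have h2 : 1 - c' = 0 := (smul_eq_zero.1 h1).resolve_right (hv i)
  have h3 : c = 1 := by linear_combination hcc - h2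
  rw [hc, h3, one_smul]

/-- A map preserving product vectors that fixes the star of one product vector fixes every
product vector. -/
theorem map_eq_self_of_fixesStar {e : ∀ i, V i} (he : ∀ i, e i ≠ 0) (hfix : FixesStar τ Ψ e)
    (w : ∀ i, V i) : Ψ (τ w) = τ w := by
  by_cases hw : ∀ i, w i ≠ 0
  · have key : ∀ S : Finset ι, FixesStar τ Ψ (S.piecewise w e) := by
      intro S
      induction S using Finset.induction_on with
      | empty => simpa using hfix
      | insert a S ha ih =>
        rw [Finset.piecewise_insert]
        refine hτ.fixesStar_update hinj hmap (fun i => ?_) ih (hw a)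
        by_cases hi : i ∈ S <;> simp [hi, hw i, he i]
    by_cases hι : Nonempty ι
    · obtain ⟨i⟩ := hι
      have := key Finset.univ i (w i)
      simpa using this
    · obtain ⟨r, hr⟩ := hmap w
      rw [hr]
      congr 1
      funext i
      exact absurd ⟨i⟩ hι
  · push Not at hw
    obtain ⟨i, hi⟩ := hw
    rw [τ.map_coord_zero i hi, map_zero]

/-- A map preserving product vectors sends a line in the direction of one factor to a line in the
direction of some factor. -/
theorem exists_direction {e r : ∀ i, V i} (he : ∀ i, e i ≠ 0) (hr : Ψ (τ e) = τ r) {i : ι}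
    (hi : ∃ f : V i, ¬∃ c : ℂ, f = c • e i) :
    ∃ j, ∀ u, ∃ s, Ψ (τ (update e i u)) = τ (update r j s) := by
  have hne : ∀ {v : ∀ i, V i}, (∀ i, v i ≠ 0) → ∀ {t}, Ψ (τ v) = τ t → ∀ k, t k ≠ 0 := by
    intro v hv t ht
    refine ne_zero_of_map_ne_zero (τ := τ) ?_
    rw [← ht]
    exact fun h => hτ.ne_zero v hv (hinj (by rw [h, map_zero]))
  have hr0 := hne he hr
  obtain ⟨f, hf⟩ := hi
  have hf0 : f ≠ 0 := fun h => hf ⟨0, by simpa using h⟩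
  obtain ⟨t, ht⟩ := hmap (update e i f)
  have ht0 := hne (update_ne_zero he hf0) ht
  obtain ⟨j, hj⟩ : ∃ j, ∀ l ≠ j, ∃ c : ℂ, t l = c • r l := by
    obtain ⟨x, hx⟩ := hmap (update e i (e i + f))
    refine hτ.exists_of_add _ _ x hr0 ht0 ?_
    rw [← hx, τ.map_update_add, map_add, update_eq_self, hr, ht]
  have htj : ¬∃ c : ℂ, t j = c • r j := by
    rintro ⟨c, hc⟩
    have hpar : ∀ k, ∃ c : ℂ, t k = c • r k := by
      intro k
      rcases eq_or_ne k j with rfl | h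
      · exact ⟨c, hc⟩
      · exact hj k h
    choose d hd using hpar
    have h1 : τ t = (∏ k, d k) • τ r := by
      rw [← τ.map_smul_univ]
      congr 1
      funext k
      exact hd k
    have h2 : τ (update e i f) = (∏ k, d k) • τ e := by
      apply hinj
      rw [ht, h1, map_smul, hr]
    have h3 := hτ.parallel_of_eq_smul he (update_ne_zero he hf0) h2 i
    rw [update_self] at h3
    exact hf h3
  refine ⟨j, fun u => ?_⟩
  by_cases hu0 : u = 0
  · exact ⟨0, by rw [hu0, τ.map_update_zero, τ.map_update_zero, map_zero]⟩
  obtain ⟨p, hp⟩ := hmap (update e i u)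
  have hp0 := hne (update_ne_zero he hu0) hp
  obtain ⟨j₁, hj₁⟩ : ∃ j, ∀ l ≠ j, ∃ c : ℂ, p l = c • r l := by
    obtain ⟨x, hx⟩ := hmap (update e i (e i + u))
    refine hτ.exists_of_add _ _ x hr0 hp0 ?_
    rw [← hx, τ.map_update_add, map_add, update_eq_self, hr, hp]
  obtain ⟨j₂, hj₂⟩ : ∃ j, ∀ l ≠ j, ∃ c : ℂ, p l = c • t l := by
    obtain ⟨x, hx⟩ := hmap (update e i (f + u))
    refine hτ.exists_of_add _ _ x ht0 hp0 ?_
    rw [← hx, τ.map_update_add, map_add, ht, hp]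
  -- The image `p` lies on a line with `r` and on a line with `t`. If the first had a direction
  -- other than `j`, then `p j` would be parallel to `r j`; as `t j` is not, the second line has
  -- direction `j`.
  have hpr : ∀ l ≠ j, ∃ c : ℂ, p l = c • r l := by
    rcases eq_or_ne j₁ j with rfl | h1
    · exact hj₁
    · have h2 : j₂ = j := by
        by_contra h2
        exact htj (parallel_trans (hp0 j) (hj₁ j h1.symm) (hj₂ j (Ne.symm h2)))
      subst h2
      intro l hl
      obtain ⟨c, hc⟩ := hj₂ l hl
      obtain ⟨d, hd⟩ := hj l hl
      exact ⟨c * d, by rw [hc, hd, smul_smul]⟩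
  obtain ⟨C, hC⟩ := exists_smul_of_parallel' (τ := τ) hpr
  exact ⟨_, hp.trans hC⟩

end IsSegre

end Segre

end SchmidtIsometry

/-! ### Recovering a set of unit vectors from its support function. -/

namespace SchmidtIsometry

/-- A linear map whose pairing with a compact set `E` of unit vectors, stable under phases, has the
same maximal modulus as that of the identity covers `E` by the image of `E`. -/
theorem subset_image_of_sSup_inner_eq {H : Type*} [NormedAddCommGroup H] [InnerProductSpace ℂ H]
    {E : Set H} (hE : IsCompact E) (hunit : ∀ z ∈ E, ‖z‖ = 1)
    (hphase : ∀ z ∈ E, ∀ c : ℂ, ‖c‖ = 1 → c • z ∈ E) (Ψ : H →L[ℂ] H)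
    (h : ∀ X : H, sSup {r : ℝ | ∃ z ∈ E, r = ‖inner ℂ (Ψ z) X‖} =
      sSup {r : ℝ | ∃ z ∈ E, r = ‖inner ℂ z X‖}) : E ⊆ Ψ '' E := by
  -- Testing the hypothesis on `X = Ψ z` gives `‖Ψ z‖² ≤ ‖Ψ z‖`.
  have hle : ∀ z ∈ E, ‖Ψ z‖ ≤ 1 := by
    intro z hz
    have hb : BddAbove {r : ℝ | ∃ z' ∈ E, r = ‖inner ℂ (Ψ z') (Ψ z)‖} := by
      refine ⟨‖Ψ‖ * ‖Ψ z‖, ?_⟩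
      rintro r ⟨z', hz', rfl⟩
      refine (norm_inner_le_norm _ _).trans ?_
      gcongr
      simpa [hunit z' hz'] using Ψ.le_opNorm z'
    have h1 : ‖Ψ z‖ * ‖Ψ z‖ ≤ ‖Ψ z‖ := by
      calc ‖Ψ z‖ * ‖Ψ z‖ = ‖inner ℂ (Ψ z) (Ψ z)‖ := by
            rw [← inner_self_eq_norm_mul_norm (𝕜 := ℂ), inner_self_re_eq_norm]
        _ ≤ sSup {r : ℝ | ∃ z' ∈ E, r = ‖inner ℂ (Ψ z') (Ψ z)‖} := le_csSup hb ⟨z, hz, rfl⟩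
        _ ≤ ‖Ψ z‖ := by
          rw [h]
          refine csSup_le ⟨_, z, hz, rfl⟩ ?_
          rintro r ⟨z', hz', rfl⟩
          refine (norm_inner_le_norm _ _).trans ?_
          rw [hunit z' hz', one_mul]
    nlinarith [norm_nonneg (Ψ z)]
  intro z₀ hz₀
  -- Test on `X = z₀`: the supremum is 1 and is attained at `z₁`, so Cauchy–Schwarz is an equality
  -- and `z₀` is a unit multiple of `Ψ z₁`.
  obtain ⟨z₁, hz₁, hmax⟩ := hE.exists_isMaxOn ⟨z₀, hz₀⟩
    (f := fun z => ‖inner ℂ (Ψ z) z₀‖) (by fun_prop)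
  have h1 : sSup {r : ℝ | ∃ z ∈ E, r = ‖inner ℂ (Ψ z) z₀‖} = ‖inner ℂ (Ψ z₁) z₀‖ := by
    refine IsGreatest.csSup_eq ⟨⟨z₁, hz₁, rfl⟩, ?_⟩
    rintro r ⟨z, hz, rfl⟩
    exact hmax hz
  have h2 : sSup {r : ℝ | ∃ z ∈ E, r = ‖inner ℂ z z₀‖} = 1 := by
    refine IsGreatest.csSup_eq ⟨⟨z₀, hz₀, ?_⟩, ?_⟩
    · rw [← inner_self_re_eq_norm, inner_self_eq_norm_mul_norm, hunit z₀ hz₀, one_mul]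
    · rintro r ⟨z, hz, rfl⟩
      refine (norm_inner_le_norm _ _).trans ?_
      rw [hunit z hz, hunit z₀ hz₀, one_mul]
  have h3 : ‖inner ℂ (Ψ z₁) z₀‖ = 1 := by rw [← h1, h, h2]
  have h4 : ‖Ψ z₁‖ = 1 := by
    refine le_antisymm (hle z₁ hz₁) ?_
    have := norm_inner_le_norm (𝕜 := ℂ) (Ψ z₁) z₀
    rwa [h3, hunit z₀ hz₀, mul_one] at this
  have h5 : Ψ z₁ ≠ 0 := by
    intro h0
    simp [h0] at h4
  have h6 : z₀ ≠ 0 := by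
    intro h0
    have := hunit z₀ hz₀
    simp [h0] at this
  have h7 : Ψ z₁ = 0 ∨ ∃ c : ℂ, z₀ = c • Ψ z₁ :=
    ((norm_inner_eq_norm_tfae ℂ (Ψ z₁) z₀).out 0 2).1 (by rw [h3, h4, hunit z₀ hz₀, one_mul])
  obtain ⟨c, hc⟩ := h7.resolve_left h5
  refine ⟨c • z₁, hphase z₁ hz₁ c ?_, by rw [map_smul, hc]⟩
  have := hunit z₀ hz₀
  rwa [hc, norm_smul, h4, mul_one] at this

end SchmidtIsometry

/-! ### Hilbert–Schmidt picture of the norm, and invariance under the elementary maps. -/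

namespace SchmidtIsometry

open Matrix Module
open scoped ComplexOrder

variable {m n : ℕ}

/-- The coefficient matrix of a bipartite vector. -/
def coeffMatrix : (Fin m × Fin n → ℂ) →ₗ[ℂ] Matrix (Fin m) (Fin n) ℂ where
  toFun v := Matrix.of fun i j => v (i, j)
  map_add' _ _ := rfl
  map_smul' _ _ := rfl

/-- The vectors of Schmidt rank at most `k`. -/
def lowSchmidt (m n k : ℕ) : Set (Fin m × Fin n → ℂ) := {v | (coeffMatrix v).rank ≤ k}

theorem coeffMatrix_apply (v : Fin m × Fin n → ℂ) (i : Fin m) (j : Fin n) :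
    coeffMatrix v i j = v (i, j) := rfl

theorem mem_lowSchmidt {k : ℕ} {v : Fin m × Fin n → ℂ} :
    v ∈ lowSchmidt m n k ↔ (coeffMatrix v).rank ≤ k := Iff.rfl

/-- The operators `|w⟩⟨y|` with `w` and `y` of Schmidt rank at most `k`. -/
def lowOp (m n k : ℕ) : Set (BipartiteOp m n) :=
  {z | ∃ w ∈ lowSchmidt m n k, ∃ y ∈ lowSchmidt m n k, z = vecMulVec w y}

theorem smul_mem_lowSchmidt {k : ℕ} {v : Fin m × Fin n → ℂ} (hv : v ∈ lowSchmidt m n k) (c : ℂ) :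
    c • v ∈ lowSchmidt m n k := by
  rcases eq_or_ne c 0 with rfl | hc
  · simp [lowSchmidt, Matrix.rank_zero]
  · rw [mem_lowSchmidt, map_smul,
      Matrix.rank_smul_of_mem_nonZeroDivisors _ (mem_nonZeroDivisors_of_ne_zero hc)]
    exact hv

theorem star_mem_lowSchmidt {k : ℕ} {v : Fin m × Fin n → ℂ} (hv : v ∈ lowSchmidt m n k) :
    star v ∈ lowSchmidt m n k := by
  have h : coeffMatrix (star v) = (coeffMatrix v)ᴴᵀ := rfl
  rw [mem_lowSchmidt, h, Matrix.rank_transpose, Matrix.rank_conjTranspose]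
  exact hv

theorem rank_le_of_mul {a b c d : ℕ} (A : Matrix (Fin a) (Fin b) ℂ) (X : Matrix (Fin b) (Fin c) ℂ)
    (B : Matrix (Fin c) (Fin d) ℂ) : (A * X * B).rank ≤ X.rank :=
  (Matrix.rank_mul_le_left _ _).trans (Matrix.rank_mul_le_right _ _)

theorem coeffMatrix_kronecker_mulVec (W : Matrix (Fin m) (Fin m) ℂ) (Y : Matrix (Fin n) (Fin n) ℂ)
    (v : Fin m × Fin n → ℂ) : coeffMatrix ((W ⊗ₖ Y) *ᵥ v) = W * coeffMatrix v * Yᵀ := by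
  ext i j
  simp only [coeffMatrix_apply, Matrix.mulVec,
    dotProduct, Matrix.kroneckerMap_apply, Fintype.sum_prod_type, Matrix.mul_apply,
    Matrix.transpose_apply, Finset.sum_mul]
  rw [Finset.sum_comm]
  exact Finset.sum_congr rfl fun _ _ => Finset.sum_congr rfl fun _ _ => by ring

theorem swapOp_mulVec (v : Fin n × Fin n → ℂ) :
    swapOp (rfl : n = n) *ᵥ v = fun p => v p.swap := by
  funext ⟨s, t⟩
  have key : ∀ q : Fin n × Fin n,
      swapOp (rfl : n = n) (s, t) q * v q = if q = (t, s) then v q else 0 := by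
    rintro ⟨i, j⟩
    by_cases h : s = j ∧ t = i
    · obtain ⟨rfl, rfl⟩ := h
      simp [swapOp]
    · have h' : ¬(i = t ∧ j = s) := fun e => h ⟨e.2.symm, e.1.symm⟩
      simp [swapOp, h, h']
  simp [Matrix.mulVec, dotProduct, key]

/-- On coefficient matrices `W ⊗ Y` acts as `A ↦ W A Yᵀ` and the swap as transposition; neither
raises the rank. -/
theorem IsLocalUnitary.mulVec_mem {U : BipartiteOp m n} (hU : IsLocalUnitary U) {k : ℕ}
    {v : Fin m × Fin n → ℂ} (hv : v ∈ lowSchmidt m n k) : U *ᵥ v ∈ lowSchmidt m n k := by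
  have h1 : ∀ (W : Matrix (Fin m) (Fin m) ℂ) (Y : Matrix (Fin n) (Fin n) ℂ),
      (W ⊗ₖ Y) *ᵥ v ∈ lowSchmidt m n k := by
    intro W Y
    rw [mem_lowSchmidt, coeffMatrix_kronecker_mulVec]
    exact (rank_le_of_mul _ _ _).trans hv
  rcases hU with ⟨W, -, Y, -, rfl⟩ | ⟨h, W, -, Y, -, rfl⟩
  · exact h1 W Y
  · subst h
    rw [← Matrix.mulVec_mulVec, swapOp_mulVec]
    have h2 : coeffMatrix (fun p : Fin n × Fin n => ((W ⊗ₖ Y) *ᵥ v) p.swap) =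
      (coeffMatrix ((W ⊗ₖ Y) *ᵥ v))ᵀ := rfl
    rw [mem_lowSchmidt, h2, Matrix.rank_transpose]
    exact h1 W Y

theorem swapOp_transpose : (swapOp (rfl : n = n))ᵀ = swapOp (rfl : n = n) := by
  ext ⟨i, j⟩ ⟨s, t⟩
  simp only [swapOp, Matrix.transpose_apply, Matrix.of_apply, Fin.cast_eq_self]
  congr 1
  apply propext
  constructor <;> rintro ⟨rfl, rfl⟩ <;> exact ⟨rfl, rfl⟩

theorem swapOp_conjTranspose : (swapOp (rfl : n = n))ᴴ = swapOp (rfl : n = n) := by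
  have h : (swapOp (rfl : n = n)).map star = swapOp (rfl : n = n) := by
    ext i j
    simp only [swapOp, Matrix.map_apply, Matrix.of_apply]
    split_ifs <;> simp
  rw [Matrix.conjTranspose, swapOp_transpose, h]

theorem ext_mulVec {A B : BipartiteOp m n} (h : ∀ v, A *ᵥ v = B *ᵥ v) : A = B :=
  Matrix.mulVec_injective (funext h)

theorem swapOp_mul_self : swapOp (rfl : n = n) * swapOp (rfl : n = n) = 1 := by
  refine ext_mulVec fun v => ?_
  rw [← Matrix.mulVec_mulVec, swapOp_mulVec, swapOp_mulVec, Matrix.one_mulVec]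
  rfl

theorem swapOp_mul_kronecker (W Y : Matrix (Fin n) (Fin n) ℂ) :
    swapOp (rfl : n = n) * (W ⊗ₖ Y) = (Y ⊗ₖ W) * swapOp (rfl : n = n) := by
  refine ext_mulVec fun v => ?_
  rw [← Matrix.mulVec_mulVec, ← Matrix.mulVec_mulVec, swapOp_mulVec, swapOp_mulVec]
  funext ⟨i, j⟩
  simp only [Matrix.mulVec, dotProduct, Matrix.kroneckerMap_apply, Fintype.sum_prod_type,
    Prod.swap]
  rw [Finset.sum_comm]
  exact Finset.sum_congr rfl fun _ _ => Finset.sum_congr rfl fun _ _ => by ring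

theorem conjTranspose_mem_unitaryGroup {a : ℕ} {W : Matrix (Fin a) (Fin a) ℂ}
    (hW : W ∈ unitaryGroup (Fin a) ℂ) : Wᴴ ∈ unitaryGroup (Fin a) ℂ := by
  rw [mem_unitaryGroup_iff'] at hW
  rw [mem_unitaryGroup_iff, Matrix.star_eq_conjTranspose, conjTranspose_conjTranspose]
  exact hW

theorem transpose_mem_unitaryGroup {a : ℕ} {W : Matrix (Fin a) (Fin a) ℂ}
    (hW : W ∈ unitaryGroup (Fin a) ℂ) : Wᵀ ∈ unitaryGroup (Fin a) ℂ := by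
  rw [mem_unitaryGroup_iff'] at hW
  rw [mem_unitaryGroup_iff]
  have h : star Wᵀ = (star W)ᵀ := rfl
  rw [h, ← Matrix.transpose_mul, hW, Matrix.transpose_one]

theorem IsLocalUnitary.mem_unitaryGroup {U : BipartiteOp m n} (hU : IsLocalUnitary U) :
    U ∈ unitaryGroup (Fin m × Fin n) ℂ := by
  rcases hU with ⟨W, hW, Y, hY, rfl⟩ | ⟨h, W, hW, Y, hY, rfl⟩
  · exact kronecker_mem_unitary hW hY
  · subst h
    refine mul_mem ?_ (kronecker_mem_unitary hW hY)
    rw [mem_unitaryGroup_iff, Matrix.star_eq_conjTranspose, swapOp_conjTranspose, swapOp_mul_self]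

theorem IsLocalUnitary.conjTranspose {U : BipartiteOp m n} (hU : IsLocalUnitary U) :
    IsLocalUnitary Uᴴ := by
  rcases hU with ⟨W, hW, Y, hY, rfl⟩ | ⟨h, W, hW, Y, hY, rfl⟩
  · exact Or.inl ⟨_, conjTranspose_mem_unitaryGroup hW, _, conjTranspose_mem_unitaryGroup hY,
      conjTranspose_kronecker _ _⟩
  · subst h
    refine Or.inr ⟨rfl, _, conjTranspose_mem_unitaryGroup hY, _, conjTranspose_mem_unitaryGroup hW,
      ?_⟩
    rw [conjTranspose_mul, swapOp_conjTranspose, conjTranspose_kronecker, ← swapOp_mul_kronecker]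

theorem IsLocalUnitary.transpose {U : BipartiteOp m n} (hU : IsLocalUnitary U) :
    IsLocalUnitary Uᵀ := by
  rcases hU with ⟨W, hW, Y, hY, rfl⟩ | ⟨h, W, hW, Y, hY, rfl⟩
  · exact Or.inl ⟨_, transpose_mem_unitaryGroup hW, _, transpose_mem_unitaryGroup hY,
      (kroneckerMap_transpose _ _ _).symm⟩
  · subst h
    refine Or.inr ⟨rfl, _, transpose_mem_unitaryGroup hY, _, transpose_mem_unitaryGroup hW, ?_⟩
    rw [transpose_mul, swapOp_transpose, ← kroneckerMap_transpose, ← swapOp_mul_kronecker]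

/-- Operators as vectors of a Hilbert space, with the Hilbert–Schmidt inner product. -/
noncomputable def toHilbert (m n : ℕ) :
    BipartiteOp m n ≃ₗ[ℂ] EuclideanSpace ℂ ((Fin m × Fin n) × (Fin m × Fin n)) where
  toFun X := WithLp.toLp 2 fun p => X p.1 p.2
  map_add' _ _ := rfl
  map_smul' _ _ := rfl
  invFun x := Matrix.of fun p q => x (p, q)
  left_inv _ := rfl
  right_inv _ := rfl

theorem toHilbert_apply (X : BipartiteOp m n) (p : (Fin m × Fin n) × (Fin m × Fin n)) :
    toHilbert m n X p = X p.1 p.2 := rfl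

/-- The Hilbert–Schmidt inner product. -/
noncomputable def hsInner (X Y : BipartiteOp m n) : ℂ := inner ℂ (toHilbert m n X) (toHilbert m n Y)

theorem hsInner_eq_sum (X Y : BipartiteOp m n) :
    hsInner X Y = ∑ p, ∑ q, star (X p q) * Y p q := by
  rw [hsInner, PiLp.inner_apply, Fintype.sum_prod_type]
  simp only [toHilbert_apply, RCLike.inner_apply, RCLike.star_def, mul_comm]

theorem hsInner_eq_trace (X Y : BipartiteOp m n) : hsInner X Y = (Xᴴ * Y).trace := by
  rw [hsInner_eq_sum, Finset.sum_comm]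
  simp only [Matrix.trace, Matrix.diag, Matrix.mul_apply, Matrix.conjTranspose_apply]

theorem norm_toHilbert_vecMulVec (w y : Fin m × Fin n → ℂ) :
    ‖toHilbert m n (vecMulVec w y)‖ =
      ‖(WithLp.toLp 2 w : BipartiteVec m n)‖ * ‖(WithLp.toLp 2 y : BipartiteVec m n)‖ := by
  rw [EuclideanSpace.norm_eq, EuclideanSpace.norm_eq, EuclideanSpace.norm_eq,
    ← Real.sqrt_mul (Finset.sum_nonneg fun _ _ => sq_nonneg _), Finset.sum_mul_sum,
    Fintype.sum_prod_type]
  simp [toHilbert_apply, vecMulVec_apply, mul_pow]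

theorem braOpKet_eq_hsInner (w y : BipartiteVec m n) (X : BipartiteOp m n) :
    braOpKet w X y = hsInner (vecMulVec w.ofLp (star y.ofLp)) X := by
  rw [hsInner_eq_sum, braOpKet, PiLp.inner_apply]
  refine Finset.sum_congr rfl fun p _ => ?_
  simp only [RCLike.inner_apply, Matrix.toLpLin_apply, Matrix.mulVec, dotProduct, Finset.sum_mul,
    vecMulVec_apply, Pi.star_apply, star_mul', RCLike.star_def, RingHomCompTriple.comp_apply,
    RingHom.id_apply]
  exact Finset.sum_congr rfl fun q _ => by ring

/-- The elements of `lowOp` of Hilbert–Schmidt norm one. -/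
def lowSphere (m n k : ℕ) : Set (BipartiteOp m n) :=
  {z | z ∈ lowOp m n k ∧ ‖toHilbert m n z‖ = 1}

theorem mem_lowSphere_iff {k : ℕ} {z : BipartiteOp m n} :
    z ∈ lowSphere m n k ↔ ∃ w y : BipartiteVec m n, ‖w‖ = 1 ∧ ‖y‖ = 1 ∧
      schmidtRank w ≤ k ∧ schmidtRank y ≤ k ∧ z = vecMulVec w.ofLp (star y.ofLp) := by
  constructor
  · rintro ⟨⟨w, hw, y, hy, rfl⟩, h1⟩
    rw [norm_toHilbert_vecMulVec] at h1
    set a := ‖(WithLp.toLp 2 w : BipartiteVec m n)‖ with ha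
    have ha0 : a ≠ 0 := left_ne_zero_of_mul_eq_one h1
    -- Only the product of the two norms is 1, so the scalar `a = ‖w‖` is moved from `w` to `y`; the
    -- conjugate turns `y` into a bra.
    refine ⟨WithLp.toLp 2 ((a : ℂ)⁻¹ • w), WithLp.toLp 2 (star ((a : ℂ) • y)), ?_, ?_,
      smul_mem_lowSchmidt hw _, star_mem_lowSchmidt (smul_mem_lowSchmidt hy _), ?_⟩
    · rw [WithLp.toLp_smul, norm_smul, ← ha, norm_inv, Complex.norm_real, ha, norm_norm, ← ha,
        inv_mul_cancel₀ ha0]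
    · have : ‖(WithLp.toLp 2 (star ((a : ℂ) • y)) : BipartiteVec m n)‖ =
          ‖(WithLp.toLp 2 ((a : ℂ) • y) : BipartiteVec m n)‖ := by
        rw [EuclideanSpace.norm_eq, EuclideanSpace.norm_eq]
        simp
      rw [this, WithLp.toLp_smul, norm_smul, Complex.norm_real, ha, norm_norm, ← ha, h1]
    · rw [star_star, vecMulVec_smul, smul_vecMulVec, smul_smul, mul_inv_cancel₀, one_smul]
      exact_mod_cast ha0
  · rintro ⟨w, y, hw, hy, hwr, hyr, rfl⟩
    refine ⟨⟨w.ofLp, hwr, star y.ofLp, star_mem_lowSchmidt hyr, rfl⟩, ?_⟩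
    rw [norm_toHilbert_vecMulVec]
    have : ‖(WithLp.toLp 2 (star y.ofLp) : BipartiteVec m n)‖ = ‖y‖ := by
      rw [EuclideanSpace.norm_eq, EuclideanSpace.norm_eq]
      simp
    rw [this, hy, WithLp.toLp_ofLp, hw, one_mul]

theorem schmidtOpNorm_eq (k : ℕ) (X : BipartiteOp m n) :
    schmidtOpNorm k X = sSup {r : ℝ | ∃ z ∈ lowSphere m n k, r = ‖hsInner z X‖} := by
  rw [schmidtOpNorm]
  congr 1
  ext r
  constructor
  · rintro ⟨w, y, hw, hy, hwr, hyr, rfl⟩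
    exact ⟨_, mem_lowSphere_iff.2 ⟨w, y, hw, hy, hwr, hyr, rfl⟩, by rw [braOpKet_eq_hsInner]⟩
  · rintro ⟨z, hz, rfl⟩
    obtain ⟨w, y, hw, hy, hwr, hyr, rfl⟩ := mem_lowSphere_iff.1 hz
    exact ⟨w, y, hw, hy, hwr, hyr, by rw [braOpKet_eq_hsInner]⟩

/-- Linear maps that preserve the Hilbert–Schmidt inner product and the set `lowOp`. -/
structure IsLowUnitary (k : ℕ) (g : Module.End ℂ (BipartiteOp m n)) : Prop where
  hsInner_map : ∀ X Y, hsInner (g X) (g Y) = hsInner X Y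
  mem_iff : ∀ z, g z ∈ lowOp m n k ↔ z ∈ lowOp m n k

theorem norm_toHilbert_sq (X : BipartiteOp m n) :
    ‖toHilbert m n X‖ ^ 2 = (hsInner X X).re := by
  rw [hsInner, ← inner_self_eq_norm_sq (𝕜 := ℂ)]
  rfl

namespace IsLowUnitary

variable {k : ℕ} {g : Module.End ℂ (BipartiteOp m n)} (hg : IsLowUnitary k g)
include hg

theorem norm_map (X : BipartiteOp m n) : ‖toHilbert m n (g X)‖ = ‖toHilbert m n X‖ := by
  have := norm_toHilbert_sq (g X)
  rw [hg.hsInner_map, ← norm_toHilbert_sq] at this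
  exact (sq_eq_sq₀ (norm_nonneg _) (norm_nonneg _)).1 this

theorem injective : Function.Injective g := by
  refine (injective_iff_map_eq_zero g).2 fun X hX => ?_
  have := hg.norm_map X
  rw [hX, map_zero, norm_zero] at this
  exact (toHilbert m n).map_eq_zero_iff.1 (norm_eq_zero.1 this.symm)

/-- The substitution `z ↦ g z` permutes `lowSphere` and keeps the pairings, so the two suprema run
over the same set of numbers. -/
theorem schmidtOpNorm_map (X : BipartiteOp m n) : schmidtOpNorm k (g X) = schmidtOpNorm k X := by
  rw [schmidtOpNorm_eq, schmidtOpNorm_eq]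
  congr 1
  ext r
  constructor
  · rintro ⟨z, hz, rfl⟩
    obtain ⟨z', rfl⟩ := LinearMap.surjective_of_injective hg.injective z
    exact ⟨z', ⟨(hg.mem_iff z').1 hz.1, by rw [← hg.norm_map, hz.2]⟩, by rw [hg.hsInner_map]⟩
  · rintro ⟨z, hz, rfl⟩
    exact ⟨g z, ⟨(hg.mem_iff z).2 hz.1, by rw [hg.norm_map, hz.2]⟩, by rw [hg.hsInner_map]⟩

theorem mul {g' : Module.End ℂ (BipartiteOp m n)} (hg' : IsLowUnitary k g') :
    IsLowUnitary k (g * g') where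
  hsInner_map X Y := by
    rw [Module.End.mul_apply, Module.End.mul_apply, hg.hsInner_map, hg'.hsInner_map]
  mem_iff z := by rw [Module.End.mul_apply, hg.mem_iff, hg'.mem_iff]

end IsLowUnitary

theorem mul_mul_mem_lowOp {U V : BipartiteOp m n} (hU : IsLocalUnitary U) (hV : IsLocalUnitary V)
    {k : ℕ} {z : BipartiteOp m n} (hz : z ∈ lowOp m n k) : U * z * V ∈ lowOp m n k := by
  obtain ⟨w, hw, y, hy, rfl⟩ := hz
  refine ⟨U *ᵥ w, hU.mulVec_mem hw, Vᵀ *ᵥ y, hV.transpose.mulVec_mem hy, ?_⟩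
  rw [mul_vecMulVec, vecMulVec_mul, mulVec_transpose]

theorem transpose_mem_lowOp {k : ℕ} {z : BipartiteOp m n} (hz : z ∈ lowOp m n k) :
    zᵀ ∈ lowOp m n k := by
  obtain ⟨w, hw, y, hy, rfl⟩ := hz
  exact ⟨y, hy, w, hw, transpose_vecMulVec _ _⟩

/-- A column space of dimension at most one is spanned by a single `a`; the entries of `b` are the
coefficients of the columns. -/
theorem exists_of_mem_lowSchmidt_one {v : Fin m × Fin n → ℂ} (hv : v ∈ lowSchmidt m n 1) :
    ∃ (a : Fin m → ℂ) (b : Fin n → ℂ), v = fun p => a p.1 * b p.2 := by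
  rw [mem_lowSchmidt, Matrix.rank, finrank_le_one_iff] at hv
  obtain ⟨⟨a, ha'⟩, ha⟩ := hv
  choose c hc using fun j : Fin n => ha ⟨_, LinearMap.mem_range_self _ (Pi.single j 1)⟩
  refine ⟨a, c, ?_⟩
  funext ⟨i, j⟩
  have := congrFun (congrArg Subtype.val (hc j)) i
  simpa [coeffMatrix_apply, mul_comm, eq_comm] using this

theorem prod_mem_lowSchmidt {k : ℕ} (hk : 1 ≤ k) (a : Fin m → ℂ) (b : Fin n → ℂ) :
    (fun p : Fin m × Fin n => a p.1 * b p.2) ∈ lowSchmidt m n k := by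
  have h : coeffMatrix (fun p : Fin m × Fin n => a p.1 * b p.2) = vecMulVec a b := rfl
  rw [mem_lowSchmidt, h]
  exact (rank_vecMulVec_le _ _).trans hk

/-- Partial transposition exchanges the second factors of ket and bra, which makes sense on product
vectors only; hence the bound 1. -/
theorem partialTranspose_mem_lowOp {z : BipartiteOp m n} (hz : z ∈ lowOp m n 1) :
    partialTransposeMap m n z ∈ lowOp m n 1 := by
  obtain ⟨w, hw, y, hy, rfl⟩ := hz
  obtain ⟨a, b, rfl⟩ := exists_of_mem_lowSchmidt_one hw
  obtain ⟨c, d, rfl⟩ := exists_of_mem_lowSchmidt_one hy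
  refine ⟨_, prod_mem_lowSchmidt le_rfl a d, _, prod_mem_lowSchmidt le_rfl c b, ?_⟩
  ext p q
  rw [show ∀ z : BipartiteOp m n, partialTransposeMap m n z p q = z (p.1, q.2) (q.1, p.2) from
    fun _ => rfl]
  simp only [vecMulVec_apply]
  ring

theorem IsElementary.isLowUnitary {k : ℕ} {g : Module.End ℂ (BipartiteOp m n)}
    (hg : IsElementary k m n g) : IsLowUnitary k g := by
  rcases hg with ⟨U, V, hU, hV⟩ | _ | hk
  · have hU1 := mem_unitaryGroup_iff'.1 hU.mem_unitaryGroup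
    have hV1 := mem_unitaryGroup_iff.1 hV.mem_unitaryGroup
    rw [star_eq_conjTranspose] at hU1 hV1
    have happ : ∀ X, mulLeftRight U V X = U * X * V := fun _ => rfl
    refine ⟨fun X Y => ?_, fun z => ⟨fun h => ?_, mul_mul_mem_lowOp hU hV⟩⟩
    · rw [hsInner_eq_trace, hsInner_eq_trace, happ, happ, conjTranspose_mul, conjTranspose_mul,
        trace_mul_comm]
      have : U * Y * V * (Vᴴ * (Xᴴ * Uᴴ)) = U * (Y * (V * Vᴴ) * Xᴴ) * Uᴴ := by
        simp only [Matrix.mul_assoc]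
      rw [this, hV1, Matrix.mul_one, trace_mul_comm, ← Matrix.mul_assoc, hU1, Matrix.one_mul,
        trace_mul_comm]
    · have h2 := mul_mul_mem_lowOp hU.conjTranspose hV.conjTranspose h
      have h3 : Uᴴ * (mulLeftRight U V z) * Vᴴ = (Uᴴ * U) * z * (V * Vᴴ) := by
        rw [happ]
        simp only [Matrix.mul_assoc]
      rwa [h3, hU1, hV1, Matrix.one_mul, Matrix.mul_one] at h2
  -- The map is an involution by definition, so one inclusion serves for both; likewise for the
  -- partial transpose below.
  · refine ⟨fun X Y => ?_, fun z => ⟨fun h => transpose_mem_lowOp h, transpose_mem_lowOp⟩⟩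
    rw [hsInner_eq_sum, hsInner_eq_sum, Finset.sum_comm]
    rfl
  · subst hk
    refine ⟨fun X Y => ?_, fun z => ⟨fun h => partialTranspose_mem_lowOp h,
      partialTranspose_mem_lowOp⟩⟩
    rw [hsInner_eq_sum, hsInner_eq_sum]
    simp only [Fintype.sum_prod_type]
    refine Finset.sum_congr rfl fun i _ => ?_
    rw [Finset.sum_comm]
    conv_rhs => rw [Finset.sum_comm]
    refine Finset.sum_congr rfl fun j _ => ?_
    rw [Finset.sum_comm]
    rfl

theorem isLowUnitary_of_isCompositionOfElementary {k : ℕ} {Φ : Module.End ℂ (BipartiteOp m n)}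
    (h : IsCompositionOfElementary k m n Φ) : IsLowUnitary k Φ := by
  induction h using Subsemigroup.closure_induction with
  | mem x hx => exact IsElementary.isLowUnitary hx
  | mul x y _ _ hx hy => exact hx.mul hy

end SchmidtIsometry

/-! ### Compactness, and the adjoint of an isometry. -/

namespace SchmidtIsometry

open Matrix Module

variable {m n : ℕ}

theorem le_rank_of_linearIndependent {a b r : ℕ} {A : Matrix (Fin a) (Fin b) ℂ}
    {q : Fin r → Fin b → ℂ} (h : LinearIndependent ℂ fun i => A *ᵥ q i) : r ≤ A.rank := by
  have h1 : LinearIndependent ℂ fun i =>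
      (⟨A *ᵥ q i, LinearMap.mem_range_self A.mulVecLin (q i)⟩ : LinearMap.range A.mulVecLin) :=
    LinearIndependent.of_comp (LinearMap.range A.mulVecLin).subtype h
  have h2 := h1.fintype_card_le_finrank
  rwa [Fintype.card_fin] at h2

theorem exists_linearIndependent_of_le_rank {a b r : ℕ} {A : Matrix (Fin a) (Fin b) ℂ}
    (h : r ≤ A.rank) : ∃ q : Fin r → Fin b → ℂ, LinearIndependent ℂ fun i => A *ᵥ q i := by
  have h' : r ≤ finrank ℂ (LinearMap.range A.mulVecLin) := h
  obtain ⟨B⟩ : Nonempty (Basis (Fin (finrank ℂ (LinearMap.range A.mulVecLin))) ℂ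
    (LinearMap.range A.mulVecLin)) := ⟨finBasis ℂ _⟩
  choose q hq using fun i => (B i).2
  refine ⟨fun i => q (Fin.castLE h' i), ?_⟩
  have h1 : LinearIndependent ℂ ((LinearMap.range A.mulVecLin).subtype ∘ B) :=
    B.linearIndependent.map' _ (Submodule.ker_subtype _)
  have h2 := h1.comp (Fin.castLE h') (Fin.castLE_injective h')
  have h3 : (fun i => A *ᵥ q (Fin.castLE h' i)) =
      ((LinearMap.range A.mulVecLin).subtype ∘ B) ∘ Fin.castLE h' := by
    funext i
    exact hq _
  rw [h3]
  exact h2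

theorem continuous_coeffMatrix_mulVec (q : Fin n → ℂ) :
    Continuous fun v : Fin m × Fin n → ℂ => coeffMatrix v *ᵥ q := by
  refine continuous_pi fun i => ?_
  simp only [mulVec, dotProduct, coeffMatrix_apply]
  fun_prop

/-- Rank above `k` is witnessed by `k + 1` vectors with independent images, and independence is an
open condition. -/
theorem isClosed_lowSchmidt (k : ℕ) : IsClosed (lowSchmidt m n k) := by
  rw [← isOpen_compl_iff, isOpen_iff_mem_nhds]
  intro v hv
  obtain ⟨q, hq⟩ := exists_linearIndependent_of_le_rank (Nat.succ_le_of_lt (not_le.1 hv))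
  have hc : Continuous fun (v : Fin m × Fin n → ℂ) i => coeffMatrix v *ᵥ q i :=
    continuous_pi fun i => continuous_coeffMatrix_mulVec (q i)
  filter_upwards [hc.continuousAt.eventually hq.eventually] with w hw
  exact not_le.2 (Nat.lt_of_succ_le (le_rank_of_linearIndependent hw))

theorem isCompact_image_lowSphere (k : ℕ) :
    IsCompact (toHilbert m n '' lowSphere m n k) := by
  have hS : IsCompact {w : BipartiteVec m n | ‖w‖ = 1 ∧ schmidtRank w ≤ k} := by
    have h1 : IsCompact (Metric.sphere (0 : BipartiteVec m n) 1) := isCompact_sphere _ _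
    have h2 : IsClosed ((fun w : BipartiteVec m n => w.ofLp) ⁻¹' lowSchmidt m n k) :=
      (isClosed_lowSchmidt k).preimage (PiLp.continuous_ofLp 2 _)
    convert h1.inter_right h2 using 1
    ext w
    simp only [Set.mem_inter_iff, mem_sphere_zero_iff_norm, Set.mem_preimage]
    rfl
  have hc : Continuous fun p : BipartiteVec m n × BipartiteVec m n =>
      toHilbert m n (vecMulVec p.1.ofLp (star p.2.ofLp)) := by
    refine (PiLp.continuous_toLp 2 _).comp (continuous_pi fun q => ?_)
    simp only [vecMulVec_apply, Pi.star_apply]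
    fun_prop
  convert (hS.prod hS).image hc using 1
  ext x
  constructor
  · rintro ⟨z, hz, rfl⟩
    obtain ⟨w, y, hw, hy, hwr, hyr, rfl⟩ := mem_lowSphere_iff.1 hz
    exact ⟨(w, y), ⟨⟨hw, hwr⟩, ⟨hy, hyr⟩⟩, rfl⟩
  · rintro ⟨⟨w, y⟩, ⟨⟨hw, hwr⟩, ⟨hy, hyr⟩⟩, rfl⟩
    exact ⟨_, mem_lowSphere_iff.2 ⟨w, y, hw, hy, hwr, hyr, rfl⟩, rfl⟩

theorem smul_mem_lowOp {k : ℕ} {z : BipartiteOp m n} (hz : z ∈ lowOp m n k) (c : ℂ) :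
    c • z ∈ lowOp m n k := by
  obtain ⟨w, hw, y, hy, rfl⟩ := hz
  exact ⟨c • w, smul_mem_lowSchmidt hw c, y, hy, (smul_vecMulVec _ _ _).symm⟩

theorem zero_mem_lowOp (k : ℕ) : (0 : BipartiteOp m n) ∈ lowOp m n k := by
  refine ⟨0, ?_, 0, ?_, by simp⟩ <;> simp [mem_lowSchmidt, Matrix.rank_zero]

theorem smul_mem_lowSphere {k : ℕ} {z : BipartiteOp m n} (hz : z ∈ lowOp m n k) {c : ℂ}
    (hc : ‖c‖ * ‖toHilbert m n z‖ = 1) : c • z ∈ lowSphere m n k :=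
  ⟨smul_mem_lowOp hz c, by rw [map_smul, norm_smul, hc]⟩

theorem lowSphere_subset_image {k : ℕ} {Φ Ψ : Module.End ℂ (BipartiteOp m n)}
    (hΦ : ∀ X, schmidtOpNorm k (Φ X) = schmidtOpNorm k X)
    (hadj : ∀ z X, hsInner (Ψ z) X = hsInner z (Φ X)) :
    lowSphere m n k ⊆ Ψ '' lowSphere m n k := by
  set T := toHilbert m n
  have key := subset_image_of_sSup_inner_eq (isCompact_image_lowSphere (m := m) (n := n) k) (by
      rintro _ ⟨z, hz, rfl⟩
      exact hz.2) (by
      rintro _ ⟨z, hz, rfl⟩ c hc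
      exact ⟨c • z, smul_mem_lowSphere hz.1 (by rw [hc, hz.2, one_mul]), map_smul _ _ _⟩)
    (LinearMap.toContinuousLinearMap (T.toLinearMap ∘ₗ Ψ ∘ₗ T.symm.toLinearMap)) (by
      intro x
      obtain ⟨X, rfl⟩ := T.surjective x
      have h := hΦ X
      rw [schmidtOpNorm_eq, schmidtOpNorm_eq] at h
      convert h using 2
      · ext r
        constructor
        · rintro ⟨_, ⟨z, hz, rfl⟩, rfl⟩
          refine ⟨z, hz, ?_⟩
          rw [← hadj]
          simp [hsInner, T]
        · rintro ⟨z, hz, rfl⟩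
          refine ⟨_, ⟨z, hz, rfl⟩, ?_⟩
          rw [← hadj]
          simp [hsInner, T]
      · ext r
        constructor
        · rintro ⟨_, ⟨z, hz, rfl⟩, rfl⟩
          exact ⟨z, hz, rfl⟩
        · rintro ⟨z, hz, rfl⟩
          exact ⟨_, ⟨z, hz, rfl⟩, rfl⟩)
  intro z hz
  obtain ⟨_, ⟨z', hz', rfl⟩, h⟩ := key ⟨z, hz, rfl⟩
  refine ⟨z', hz', T.injective ?_⟩
  simpa [T] using h

theorem eq_of_forall_hsInner {z z' : BipartiteOp m n} (h : ∀ X, hsInner z X = hsInner z' X) :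
    z = z' := by
  apply (toHilbert m n).injective
  refine ext_inner_right ℂ fun x => ?_
  obtain ⟨X, rfl⟩ := (toHilbert m n).surjective x
  exact h X

/-- Each entry of `X` is its pairing with a matrix unit, which is built from product vectors and so
belongs to `lowSphere` for every `k ≥ 1`. -/
theorem eq_zero_of_schmidtOpNorm {k : ℕ} (hk : 1 ≤ k) {X : BipartiteOp m n}
    (h : schmidtOpNorm k X = 0) : X = 0 := by
  have hb : BddAbove {r : ℝ | ∃ z ∈ lowSphere m n k, r = ‖hsInner z X‖} := by
    refine ⟨‖toHilbert m n X‖, ?_⟩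
    rintro r ⟨z, hz, rfl⟩
    refine (norm_inner_le_norm _ _).trans ?_
    rw [hz.2, one_mul]
  rw [schmidtOpNorm_eq] at h
  ext ⟨i, j⟩ ⟨s, t⟩
  have hz : vecMulVec (fun p : Fin m × Fin n => (Pi.single i 1 : Fin m → ℂ) p.1 *
      (Pi.single j 1 : Fin n → ℂ) p.2) (fun p : Fin m × Fin n => (Pi.single s 1 : Fin m → ℂ) p.1 *
      (Pi.single t 1 : Fin n → ℂ) p.2) ∈ lowSphere m n k := by
    refine ⟨⟨_, prod_mem_lowSchmidt hk _ _, _, prod_mem_lowSchmidt hk _ _, rfl⟩, ?_⟩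
    rw [norm_toHilbert_vecMulVec, EuclideanSpace.norm_eq, EuclideanSpace.norm_eq]
    simp [Fintype.sum_prod_type, Pi.single_apply, apply_ite norm, ite_pow]
  have h1 := le_csSup hb ⟨_, hz, rfl⟩
  rw [h, hsInner_eq_sum] at h1
  have h2 := norm_le_zero_iff.1 h1
  simpa [vecMulVec_apply, Fintype.sum_prod_type, Pi.single_apply,
    apply_ite (starRingEnd ℂ), ite_mul] using h2

theorem exists_adjoint (Φ : Module.End ℂ (BipartiteOp m n)) :
    ∃ Ψ : Module.End ℂ (BipartiteOp m n), ∀ z X, hsInner (Ψ z) X = hsInner z (Φ X) := by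
  set T := toHilbert m n
  refine ⟨T.symm.toLinearMap ∘ₗ
    LinearMap.adjoint (T.toLinearMap ∘ₗ Φ ∘ₗ T.symm.toLinearMap) ∘ₗ T.toLinearMap, fun z X => ?_⟩
  simp [hsInner, T, LinearMap.adjoint_inner_left]

/-- The Hilbert–Schmidt adjoint of an isometry of the norm preserves `lowOp` and the
Hilbert–Schmidt norm of its elements. -/
theorem exists_adjoint_of_isometry {k : ℕ} (hk : 1 ≤ k) {Φ : Module.End ℂ (BipartiteOp m n)}
    (hΦ : ∀ X, schmidtOpNorm k (Φ X) = schmidtOpNorm k X) :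
    ∃ Ψ : Module.End ℂ (BipartiteOp m n), (∀ z X, hsInner (Ψ z) X = hsInner z (Φ X)) ∧
      Function.Injective Ψ ∧ (∀ z, Ψ z ∈ lowOp m n k ↔ z ∈ lowOp m n k) ∧
      ∀ z ∈ lowOp m n k, ‖toHilbert m n (Ψ z)‖ = ‖toHilbert m n z‖ := by
  have hinj : Function.Injective Φ := by
    refine (injective_iff_map_eq_zero Φ).2 fun X hX => eq_zero_of_schmidtOpNorm hk ?_
    rw [← hΦ, hX, ← zero_smul ℂ (0 : BipartiteOp m n), schmidtOpNorm_eq]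
    have : ∀ r ∈ {r : ℝ | ∃ z ∈ lowSphere m n k,
        r = ‖hsInner z ((0 : ℂ) • (0 : BipartiteOp m n))‖}, r = 0 := by
      rintro r ⟨z, -, rfl⟩
      simp [hsInner]
    exact le_antisymm (Real.sSup_nonpos fun r hr => (this r hr).le)
      (Real.sSup_nonneg fun r hr => (this r hr).ge)
  let e := LinearEquiv.ofInjectiveEndo Φ hinj
  have he : ∀ X, e X = Φ X := fun _ => rfl
  obtain ⟨Ψ, hΨ⟩ := exists_adjoint Φ
  obtain ⟨Ψ', hΨ'⟩ := exists_adjoint e.symm.toLinearMap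
  have h1 : ∀ z, Ψ' (Ψ z) = z := fun z => eq_of_forall_hsInner fun X => by
    rw [hΨ', hΨ, LinearEquiv.coe_coe, ← he, LinearEquiv.apply_symm_apply]
  have h2 : ∀ z, Ψ (Ψ' z) = z := fun z => eq_of_forall_hsInner fun X => by
    rw [hΨ, hΨ', LinearEquiv.coe_coe, ← he, LinearEquiv.symm_apply_apply]
  -- Both `Φ` and its inverse are isometries, and their adjoints `Ψ` and `Ψ'` are mutually inverse;
  -- the two inclusions together say that `Ψ` permutes `lowSphere`.
  have hsub := lowSphere_subset_image hΦ hΨ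
  have hsub' := lowSphere_subset_image (Φ := e.symm.toLinearMap) (k := k) (fun X => by
    rw [← hΦ, LinearEquiv.coe_coe, ← he, LinearEquiv.apply_symm_apply]) hΨ'
  have hΨinj : Function.Injective Ψ := Function.LeftInverse.injective h1
  have hS : ∀ z, Ψ z ∈ lowSphere m n k ↔ z ∈ lowSphere m n k := by
    intro z
    constructor
    · intro h
      obtain ⟨z', hz', hzz⟩ := hsub h
      rwa [← hΨinj hzz]
    · intro h
      obtain ⟨z', hz', rfl⟩ := hsub' h
      rwa [h2]
  have hnorm : ∀ z : BipartiteOp m n, z ≠ 0 → ‖((‖toHilbert m n z‖ : ℂ))⁻¹‖ * ‖toHilbert m n z‖ = 1 ∧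
      ((‖toHilbert m n z‖ : ℂ)) ≠ 0 := by
    intro z hz
    have : ‖toHilbert m n z‖ ≠ 0 := by simpa using hz
    refine ⟨?_, by exact_mod_cast this⟩
    rw [norm_inv, Complex.norm_real, norm_norm, inv_mul_cancel₀ this]
  refine ⟨Ψ, hΨ, hΨinj, fun z => ?_, fun z hz => ?_⟩
  · by_cases hz : z = 0
    · simp [hz, zero_mem_lowOp]
    constructor
    · intro h
      obtain ⟨ha, hb⟩ := hnorm (Ψ z) (by simpa [map_eq_zero_iff Ψ hΨinj] using hz)
      have h3 := smul_mem_lowSphere h ha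
      rw [← map_smul, hS] at h3
      have h4 := smul_mem_lowOp h3.1 (‖toHilbert m n (Ψ z)‖ : ℂ)
      rwa [smul_smul, mul_inv_cancel₀ hb, one_smul] at h4
    · intro h
      obtain ⟨ha, hb⟩ := hnorm z hz
      have h3 := smul_mem_lowSphere h ha
      rw [← hS, map_smul] at h3
      have h4 := smul_mem_lowOp h3.1 (‖toHilbert m n z‖ : ℂ)
      rwa [smul_smul, mul_inv_cancel₀ hb, one_smul] at h4
  · by_cases hz0 : z = 0
    · simp [hz0]
    obtain ⟨ha, hb⟩ := hnorm z hz0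
    have h3 := smul_mem_lowSphere hz ha
    rw [← hS, map_smul] at h3
    have h4 := h3.2
    rw [map_smul, norm_smul] at h4
    have h5 : ‖((‖toHilbert m n z‖ : ℂ))⁻¹‖ ≠ 0 := left_ne_zero_of_mul_eq_one h4
    exact mul_left_cancel₀ h5 (h4.trans ha.symm)

end SchmidtIsometry

/-! ### Lowering the bound on the Schmidt rank by counting directions of lines. -/

namespace SchmidtIsometry

open Matrix Module

variable {m n : ℕ}

section VecMulVec

variable {α β : Type*}

theorem vecMulVec_ne_zero_iff {a : α → ℂ} {b : β → ℂ} : vecMulVec a b ≠ 0 ↔ a ≠ 0 ∧ b ≠ 0 := by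
  refine ⟨fun h => ⟨?_, ?_⟩, fun h h0 => ?_⟩
  · rintro rfl
    exact h (zero_vecMulVec _)
  · rintro rfl
    exact h (by ext i j; simp [vecMulVec_apply])
  · obtain ⟨i, hi⟩ := Function.ne_iff.1 h.1
    obtain ⟨j, hj⟩ := Function.ne_iff.1 h.2
    exact mul_ne_zero hi hj (congrFun (congrFun h0 i) j)

theorem parallel_or_of_vecMulVec_add {a a' A : α → ℂ} {b b' B : β → ℂ} (ha : a ≠ 0) (hb : b ≠ 0)
    (h : vecMulVec a b + vecMulVec a' b' = vecMulVec A B) :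
    (∃ c : ℂ, a' = c • a) ∨ ∃ c : ℂ, b' = c • b := by
  have hT : ∀ x X, a x * b X + a' x * b' X = A x * B X := fun x X => congrFun (congrFun h x) X
  -- By Cauchy–Binet the 2 × 2 minors of the sum are products of a minor of `(a, a')` and a minor of
  -- `(b, b')`; they vanish since the sum has rank at most one.
  have hm : ∀ x y X Y, (a x * a' y - a y * a' x) * (b X * b' Y - b Y * b' X) = 0 := by
    intro x y X Y
    linear_combination (a y * b Y + a' y * b' Y) * hT x X + (A x * B X) * hT y Y -
      (a y * b X + a' y * b' X) * hT x Y - (A x * B Y) * hT y X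
  by_cases h1 : ∀ x y, a x * a' y - a y * a' x = 0
  · left
    obtain ⟨x, hx⟩ := Function.ne_iff.1 ha
    refine ⟨a' x / a x, funext fun y => ?_⟩
    have hx' : a x ≠ 0 := hx
    have := h1 x y
    simp only [Pi.smul_apply, smul_eq_mul]
    field_simp
    linear_combination this
  · right
    push Not at h1
    obtain ⟨x, y, hxy⟩ := h1
    obtain ⟨X, hX⟩ := Function.ne_iff.1 hb
    refine ⟨b' X / b X, funext fun Y => ?_⟩
    have hX' : b X ≠ 0 := hX
    have := (mul_eq_zero.1 (hm x y X Y)).resolve_left hxy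
    simp only [Pi.smul_apply, smul_eq_mul]
    field_simp
    linear_combination this

theorem parallel_of_vecMulVec_eq {a A : α → ℂ} {b B : β → ℂ} (hA : A ≠ 0) (hB : B ≠ 0)
    (h : vecMulVec a b = vecMulVec A B) : ∃ c : ℂ, c ≠ 0 ∧ A = c • a ∧ B = c⁻¹ • b := by
  have hT : ∀ x X, a x * b X = A x * B X := fun x X => congrFun (congrFun h x) X
  obtain ⟨x, hx⟩ := Function.ne_iff.1 hA
  obtain ⟨X, hX⟩ := Function.ne_iff.1 hB
  have hx' : A x ≠ 0 := hx
  have hX' : B X ≠ 0 := hX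
  have h0 : a x * b X ≠ 0 := by
    rw [hT]
    exact mul_ne_zero hx' hX'
  have ha := left_ne_zero_of_mul h0
  have hb := right_ne_zero_of_mul h0
  refine ⟨b X / B X, div_ne_zero hb hX', funext fun y => ?_, funext fun Y => ?_⟩
  · simp only [Pi.smul_apply, smul_eq_mul]
    field_simp
    linear_combination -hT y X
  · simp only [Pi.smul_apply, smul_eq_mul]
    have h1 := hT x X
    have h2 := hT x Y
    field_simp
    have h3 : A x * (b X * B Y - B X * b Y) = 0 := by
      linear_combination (-b X) * h2 + b Y * h1
    linear_combination (mul_eq_zero.1 h3).resolve_left hx'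

/-- The two operators add up to `2 • vecMulVec x y`, so they share a factor, which is parallel to
`x` or to `y`; their difference from `vecMulVec x y` shares it too. Thus the points `t = ±1` of a
line already determine the type of its direction. -/
theorem exists_of_add_sub {x : α → ℂ} {y : β → ℂ} (hx : x ≠ 0) (hy : y ≠ 0) {Y : Matrix α β ℂ}
    {W W' : α → ℂ} {V V' : β → ℂ} (h : vecMulVec x y + Y = vecMulVec W V)
    (h' : vecMulVec x y - Y = vecMulVec W' V') :
    (∃ x', Y = vecMulVec x' y) ∨ ∃ y', Y = vecMulVec x y' := by
  by_cases h0 : vecMulVec W V = 0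
  · left
    refine ⟨-x, ?_⟩
    rw [h0] at h
    rw [neg_vecMulVec]
    exact (neg_eq_of_add_eq_zero_right h).symm
  obtain ⟨hW, hV⟩ := vecMulVec_ne_zero_iff.1 h0
  have hsum : vecMulVec W V + vecMulVec W' V' = vecMulVec ((2 : ℂ) • x) y := by
    rw [← h, ← h', smul_vecMulVec]
    module
  have hx2 : (2 : ℂ) • x ≠ 0 := smul_ne_zero two_ne_zero hx
  rcases parallel_or_of_vecMulVec_add hW hV hsum with ⟨c, rfl⟩ | ⟨c, rfl⟩
  · right
    rw [smul_vecMulVec, ← vecMulVec_smul, ← vecMulVec_add] at hsum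
    obtain ⟨d, -, hd, -⟩ := parallel_of_vecMulVec_eq hx2 hy hsum
    obtain ⟨d', rfl⟩ := parallel_symm hx2 hd
    refine ⟨d' • (2 : ℂ) • V - y, ?_⟩
    rw [vecMulVec_sub, vecMulVec_smul, vecMulVec_smul, eq_sub_iff_add_eq, add_comm, h,
      smul_vecMulVec, smul_vecMulVec]
  · left
    rw [vecMulVec_smul, ← smul_vecMulVec, ← add_vecMulVec] at hsum
    obtain ⟨d, -, -, hd⟩ := parallel_of_vecMulVec_eq hx2 hy hsum
    obtain ⟨d', rfl⟩ := parallel_symm hy hd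
    refine ⟨d' • W - x, ?_⟩
    rw [sub_vecMulVec, eq_sub_iff_add_eq, add_comm, h, smul_vecMulVec, vecMulVec_smul]

end VecMulVec

/-- The span of the directions of the lines through `z` that stay in `lowOp`. -/
def lineSpan (k : ℕ) (z : BipartiteOp m n) : Submodule ℂ (BipartiteOp m n) :=
  Submodule.span ℂ {Y | ∀ t : ℂ, z + t • Y ∈ lowOp m n k}

theorem finrank_lineSpan_map {k : ℕ} {Ψ : Module.End ℂ (BipartiteOp m n)}
    (hinj : Function.Injective Ψ) (hmem : ∀ z, Ψ z ∈ lowOp m n k ↔ z ∈ lowOp m n k)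
    (z : BipartiteOp m n) : finrank ℂ (lineSpan k (Ψ z)) = finrank ℂ (lineSpan k z) := by
  have h : lineSpan k (Ψ z) = (lineSpan k z).map Ψ := by
    rw [lineSpan, lineSpan, Submodule.map_span]
    congr 1
    ext Y
    constructor
    · intro hY
      obtain ⟨X, rfl⟩ := LinearMap.surjective_of_injective hinj Y
      refine ⟨X, fun t => ?_, rfl⟩
      rw [← hmem, map_add, map_smul]
      exact hY t
    · rintro ⟨X, hX, rfl⟩ t
      rw [← map_smul, ← map_add, hmem]
      exact hX t
  rw [h]
  exact (Submodule.equivMapOfInjective Ψ hinj _).finrank_eq.symm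

/-- The differential of `(x, y) ↦ |x⟩⟨y|`. -/
def segreDiff (x y : Fin m × Fin n → ℂ) :
    ((Fin m × Fin n → ℂ) × (Fin m × Fin n → ℂ)) →ₗ[ℂ] BipartiteOp m n where
  toFun p := vecMulVec p.1 y + vecMulVec x p.2
  map_add' p q := by
    rw [Prod.fst_add, Prod.snd_add, add_vecMulVec, vecMulVec_add]
    abel
  map_smul' c p := by
    rw [Prod.smul_fst, Prod.smul_snd, smul_vecMulVec, vecMulVec_smul, smul_add, RingHom.id_apply]

theorem segreDiff_apply (x y : Fin m × Fin n → ℂ) (p) :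
    segreDiff x y p = vecMulVec p.1 y + vecMulVec x p.2 := rfl

/-- The kernel is the line through `(x, -y)`, the infinitesimal rescaling that leaves `vecMulVec x
y` unchanged. -/
theorem finrank_range_segreDiff {x y : Fin m × Fin n → ℂ} (hx : x ≠ 0) (hy : y ≠ 0) :
    finrank ℂ (LinearMap.range (segreDiff x y)) + 1 =
      finrank ℂ ((Fin m × Fin n → ℂ) × (Fin m × Fin n → ℂ)) := by
  have hker : LinearMap.ker (segreDiff x y) = Submodule.span ℂ {(x, -y)} := by
    ext ⟨x', y'⟩
    rw [LinearMap.mem_ker, Submodule.mem_span_singleton, segreDiff_apply]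
    constructor
    · intro h
      by_cases h0 : vecMulVec x' y = 0
      · rw [h0, zero_add] at h
        have h1 := (vecMulVec_eq_zero.1 h0).resolve_right hy
        have h2 := (vecMulVec_eq_zero.1 h).resolve_left hx
        simp only at h1 h2
        exact ⟨0, by rw [h1, h2, zero_smul]; rfl⟩
      · have hx' := (vecMulVec_ne_zero_iff.1 h0).1
        have h1 : vecMulVec x (-y') = vecMulVec x' y := by
          rw [vecMulVec_neg]
          exact (eq_neg_of_add_eq_zero_left h).symm
        obtain ⟨c, hc, h2, h3⟩ := parallel_of_vecMulVec_eq hx' hy h1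
        refine ⟨c, ?_⟩
        rw [Prod.smul_mk, h2, h3, smul_neg, smul_smul, mul_inv_cancel₀ hc, one_smul, neg_neg]
    · rintro ⟨c, hc⟩
      obtain ⟨rfl, rfl⟩ := Prod.mk.inj hc
      simp only [smul_vecMulVec, vecMulVec_smul, vecMulVec_neg, smul_neg, add_neg_cancel]
  have h1 := LinearMap.finrank_range_add_finrank_ker (segreDiff x y)
  rw [hker, finrank_span_singleton] at h1
  · exact h1
  · intro h
    exact hx (Prod.mk.inj h).1

theorem rank_add_le {a b : ℕ} (A B : Matrix (Fin a) (Fin b) ℂ) :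
    (A + B).rank ≤ A.rank + B.rank := by
  rw [Matrix.rank, mulVecLin_add]
  refine (Submodule.finrank_mono (LinearMap.range_add_le _ _)).trans ?_
  exact Submodule.finrank_add_le_finrank_add_finrank _ _

theorem add_smul_mem_lowSchmidt {k : ℕ} {x y : Fin m × Fin n → ℂ} (hx : x ∈ lowSchmidt m n k)
    (hy : y ∈ lowSchmidt m n 1) (t : ℂ) : x + t • y ∈ lowSchmidt m n (k + 1) := by
  rw [mem_lowSchmidt, map_add]
  exact (rank_add_le _ _).trans (add_le_add hx (smul_mem_lowSchmidt hy t))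

theorem single_mem_lowSchmidt {k : ℕ} (hk : 1 ≤ k) (p : Fin m × Fin n) :
    (Pi.single p 1 : Fin m × Fin n → ℂ) ∈ lowSchmidt m n k := by
  have h : (Pi.single p 1 : Fin m × Fin n → ℂ) = fun q =>
      (Pi.single p.1 1 : Fin m → ℂ) q.1 * (Pi.single p.2 1 : Fin n → ℂ) q.2 := by
    funext q
    simp only [Pi.single_apply, Prod.ext_iff]
    split_ifs <;> simp_all
  rw [h]
  exact prod_mem_lowSchmidt hk _ _

theorem mem_lowSchmidt_mono {k l : ℕ} (h : k ≤ l) {v : Fin m × Fin n → ℂ}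
    (hv : v ∈ lowSchmidt m n k) : v ∈ lowSchmidt m n l := le_trans hv h

/-- Adding a multiple of a basis product vector to `x` or `y` raises the Schmidt rank by at most
one, and the lines so obtained span the tangent space. -/
theorem range_segreDiff_le {k : ℕ} {x y : Fin m × Fin n → ℂ} (hx : x ∈ lowSchmidt m n k)
    (hy : y ∈ lowSchmidt m n k) :
    LinearMap.range (segreDiff x y) ≤ lineSpan (k + 1) (vecMulVec x y) := by
  rintro _ ⟨⟨x', y'⟩, rfl⟩
  rw [segreDiff_apply]
  have hx' : x' = ∑ p, x' p • (Pi.single p 1 : Fin m × Fin n → ℂ) := by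
    funext q
    simp [Finset.sum_apply, Pi.single_apply]
  have hy' : y' = ∑ p, y' p • (Pi.single p 1 : Fin m × Fin n → ℂ) := by
    funext q
    simp [Finset.sum_apply, Pi.single_apply]
  have h1 : ∀ x'', vecMulVec x'' y = segreDiff x y (x'', 0) := fun x'' => by
    simp [segreDiff_apply]
  have h2 : ∀ y'', vecMulVec x y'' = segreDiff x y (0, y'') := fun y'' => by
    simp [segreDiff_apply]
  refine add_mem ?_ ?_
  · have h3 : vecMulVec x' y = ∑ p, x' p • vecMulVec (Pi.single p 1) y := by
      conv_lhs => rw [hx']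
      ext i j
      simp [Matrix.sum_apply, vecMulVec_apply, Finset.sum_mul, mul_assoc]
    rw [h3]
    refine sum_mem fun p _ => Submodule.smul_mem _ _ (Submodule.subset_span fun t => ?_)
    refine ⟨x + t • Pi.single p 1, add_smul_mem_lowSchmidt hx (single_mem_lowSchmidt le_rfl p) t, y,
      mem_lowSchmidt_mono k.le_succ hy, ?_⟩
    rw [add_vecMulVec, smul_vecMulVec]
  · have h3 : vecMulVec x y' = ∑ p, y' p • vecMulVec x (Pi.single p 1) := by
      conv_lhs => rw [hy']
      ext i j
      simp [Matrix.sum_apply, vecMulVec_apply, Finset.mul_sum, mul_left_comm]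
    rw [h3]
    refine sum_mem fun p _ => Submodule.smul_mem _ _ (Submodule.subset_span fun t => ?_)
    refine ⟨x, mem_lowSchmidt_mono k.le_succ hx, y + t • Pi.single p 1,
      add_smul_mem_lowSchmidt hy (single_mem_lowSchmidt le_rfl p) t, ?_⟩
    rw [vecMulVec_add, vecMulVec_smul]

theorem exists_mulVec_eq_zero_of_rank_lt {a b : ℕ} {A : Matrix (Fin a) (Fin b) ℂ}
    (h : A.rank < b) : ∃ v, v ≠ 0 ∧ A *ᵥ v = 0 := by
  have h1 := LinearMap.finrank_range_add_finrank_ker A.mulVecLin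
  have h2 : finrank ℂ (LinearMap.range A.mulVecLin) < b := h
  rw [finrank_fin_fun] at h1
  have h3 : 0 < finrank ℂ (LinearMap.ker A.mulVecLin) := by omega
  rw [finrank_pos_iff_exists_ne_zero] at h3
  obtain ⟨⟨v, hv⟩, hv0⟩ := h3
  exact ⟨v, fun h => hv0 (Subtype.ext h), hv⟩

/-- The directions of lines through a matrix of non-maximal rank along which the rank does not
increase are orthogonal to a fixed rank-one matrix. -/
theorem exists_dotProduct_eq_zero {a b : ℕ} {A : Matrix (Fin a) (Fin b) ℂ} (ha : A.rank < a)
    (hb : A.rank < b) : ∃ u v, u ≠ 0 ∧ v ≠ 0 ∧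
      ∀ B : Matrix (Fin a) (Fin b) ℂ, (∀ t : ℂ, (A + t • B).rank ≤ A.rank) → u ⬝ᵥ (B *ᵥ v) = 0 := by
  obtain ⟨v, hv, hAv⟩ := exists_mulVec_eq_zero_of_rank_lt hb
  obtain ⟨u, hu, hAu⟩ := exists_mulVec_eq_zero_of_rank_lt (A := Aᵀ) (by rwa [rank_transpose])
  refine ⟨u, v, hu, hv, fun B hB => ?_⟩
  by_contra hs
  obtain ⟨q, hq⟩ := exists_linearIndependent_of_le_rank (A := A) le_rfl
  -- With `u` and `v` in the left and right kernels of `A`, `u ⬝ᵥ (B *ᵥ v) ≠ 0` puts `B *ᵥ v`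
  -- outside the range of `A`, so `F 0` is independent. For small `t ≠ 0` so is `F t`, which lies in
  -- the range of `A + t • B` because `B *ᵥ v = (A + t • B) *ᵥ (t⁻¹ • v)`: the rank has grown.
  let F : ℂ → Fin (A.rank + 1) → Fin a → ℂ := fun t =>
    Fin.cons (B *ᵥ v) fun i => (A + t • B) *ᵥ q i
  have hF0 : LinearIndependent ℂ (F 0) := by
    simp only [F, zero_smul, add_zero]
    rw [linearIndependent_finCons]
    refine ⟨hq, fun hmem => hs ?_⟩
    have hle : Submodule.span ℂ (Set.range fun i => A *ᵥ q i) ≤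
        LinearMap.ker (dotProductBilin ℂ ℂ u) := by
      rw [Submodule.span_le]
      rintro _ ⟨i, rfl⟩
      change u ⬝ᵥ (A *ᵥ q i) = 0
      rw [dotProduct_mulVec, ← mulVec_transpose, hAu, zero_dotProduct]
    exact hle hmem
  have hcont : Continuous F := by
    refine continuous_pi fun i => ?_
    refine Fin.cases ?_ (fun i => ?_) i
    · simp only [F, Fin.cons_zero]
      fun_prop
    · simp only [F, Fin.cons_succ, add_mulVec, smul_mulVec]
      fun_prop
  have hev : ∀ᶠ t in nhdsWithin (0 : ℂ) {0}ᶜ, LinearIndependent ℂ (F t) :=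
    (hcont.continuousAt.eventually hF0.eventually).filter_mono nhdsWithin_le_nhds
  obtain ⟨t, hli, ht⟩ := (hev.and self_mem_nhdsWithin).exists
  have ht0 : t ≠ 0 := ht
  have h1 : F t = fun i => (A + t • B) *ᵥ (Fin.cons (t⁻¹ • v) q : Fin (A.rank + 1) → Fin b → ℂ) i := by
    funext i
    refine Fin.cases ?_ (fun i => ?_) i
    · simp only [F, Fin.cons_zero]
      rw [add_mulVec, mulVec_smul, hAv, smul_zero, zero_add, smul_mulVec, mulVec_smul, smul_smul,
        mul_inv_cancel₀ ht0, one_smul]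
    · simp only [F, Fin.cons_succ]
  rw [h1] at hli
  have := (le_rank_of_linearIndependent hli).trans (hB t)
  omega

/-- When `x` has Schmidt rank exactly `k`, a line direction `vecMulVec x' y` must satisfy the linear
equation `f x' = 0` of `exists_dotProduct_eq_zero`. As `f x = 0`, the kernel of `segreDiff` respects
this equation, and so it cuts out a proper subspace of the tangent space. -/
theorem finrank_lineSpan_lt {k : ℕ} (hk : k < min m n) {x y : Fin m × Fin n → ℂ}
    (hx : x ∈ lowSchmidt m n k) (hx' : ∀ l < k, x ∉ lowSchmidt m n l) (hx0 : x ≠ 0) (hy0 : y ≠ 0) :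
    finrank ℂ (lineSpan k (vecMulVec x y)) < finrank ℂ (LinearMap.range (segreDiff x y)) := by
  have hrank : (coeffMatrix x).rank = k := by
    refine le_antisymm hx (not_lt.1 fun h => ?_)
    exact hx' _ h (mem_lowSchmidt.2 le_rfl)
  obtain ⟨u, v, hu, hv, huv⟩ := exists_dotProduct_eq_zero (A := coeffMatrix x)
    (by rw [hrank]; exact hk.trans_le (min_le_left _ _))
    (by rw [hrank]; exact hk.trans_le (min_le_right _ _))
  let f : (Fin m × Fin n → ℂ) →ₗ[ℂ] ℂ :=
    { toFun := fun x' => u ⬝ᵥ (coeffMatrix x' *ᵥ v)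
      map_add' := fun p q => by rw [map_add, add_mulVec, dotProduct_add]
      map_smul' := fun c p => by
        rw [map_smul, smul_mulVec, dotProduct_smul, RingHom.id_apply] }
  have hf : ∀ x', (∀ t : ℂ, x + t • x' ∈ lowSchmidt m n k) → f x' = 0 := by
    intro x' h
    refine huv _ fun t => ?_
    have := h t
    rw [mem_lowSchmidt, map_add, map_smul] at this
    rwa [hrank]
  have hfx : f x = 0 := hf x fun t => by
    have := smul_mem_lowSchmidt hx (1 + t)
    rwa [add_smul, one_smul] at this
  obtain ⟨x₀, hx₀⟩ : ∃ x₀, f x₀ ≠ 0 := by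
    obtain ⟨i, hi⟩ := Function.ne_iff.1 hu
    obtain ⟨j, hj⟩ := Function.ne_iff.1 hv
    refine ⟨fun p => (Pi.single i 1 : Fin m → ℂ) p.1 * (Pi.single j 1 : Fin n → ℂ) p.2, ?_⟩
    have : f (fun p => (Pi.single i 1 : Fin m → ℂ) p.1 * (Pi.single j 1 : Fin n → ℂ) p.2) =
        u i * v j := by
      change u ⬝ᵥ (vecMulVec (Pi.single i 1) (Pi.single j 1) *ᵥ v) = _
      rw [vecMulVec_mulVec]
      simp [mul_comm]
    rw [this]
    exact mul_ne_zero hi hj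
  have hle : lineSpan k (vecMulVec x y) ≤
      ((LinearMap.ker f).prod ⊤).map (segreDiff x y) := by
    rw [lineSpan, Submodule.span_le]
    intro Y hY
    obtain ⟨W, -, V, -, h1⟩ := hY 1
    obtain ⟨W', -, V', -, h2⟩ := hY (-1)
    rw [one_smul] at h1
    rw [neg_one_smul, ← sub_eq_add_neg] at h2
    rcases exists_of_add_sub hx0 hy0 h1 h2 with ⟨x', rfl⟩ | ⟨y', rfl⟩
    · refine ⟨(x', 0), ⟨?_, trivial⟩, by simp [segreDiff_apply]⟩
      refine hf x' fun t => ?_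
      obtain ⟨w, hw, y', hy', h⟩ := hY t
      rw [← smul_vecMulVec, ← add_vecMulVec] at h
      by_cases h0 : x + t • x' = 0
      · rw [h0]
        simp [mem_lowSchmidt, Matrix.rank_zero]
      · obtain ⟨c, -, hc, -⟩ := parallel_of_vecMulVec_eq h0 hy0 h.symm
        rw [hc]
        exact smul_mem_lowSchmidt hw c
    · exact ⟨(0, y'), ⟨map_zero f, trivial⟩, by simp [segreDiff_apply]⟩
  refine Submodule.finrank_lt_finrank_of_lt (lt_of_le_of_ne
    (hle.trans LinearMap.map_le_range) fun heq => ?_)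
  have hmem : segreDiff x y (x₀, 0) ∈ ((LinearMap.ker f).prod ⊤).map (segreDiff x y) :=
    hle (heq ▸ LinearMap.mem_range_self _ _)
  obtain ⟨⟨x', y'⟩, ⟨hx'0, -⟩, h⟩ := hmem
  have hker : (x' - x₀, y') ∈ LinearMap.ker (segreDiff x y) := by
    rw [LinearMap.mem_ker]
    have : (x' - x₀, y') = (x', y') - (x₀, 0) := by simp
    rw [this, map_sub, h, sub_self]
  rw [LinearMap.mem_ker, segreDiff_apply] at hker
  obtain ⟨j, hj⟩ := Function.ne_iff.1 hy0
  -- Column `j`, with `y j ≠ 0`, shows that `x' - x₀` is a multiple of `x`, where `f` vanishes; this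
  -- contradicts `f x' = 0 ≠ f x₀`.
  have h1 : y j • (x' - x₀) + y' j • x = 0 := by
    funext i
    have := congrFun (congrFun hker i) j
    simp only [Matrix.add_apply, vecMulVec_apply, Matrix.zero_apply] at this
    simp only [Pi.add_apply, Pi.smul_apply, smul_eq_mul, Pi.zero_apply]
    linear_combination this
  have h2 := congrArg f h1
  rw [map_add, map_smul, map_smul, map_sub, hfx, smul_zero, add_zero, map_zero,
    show f x' = 0 from hx'0, zero_sub, smul_eq_mul] at h2
  exact hx₀ (neg_eq_zero.1 ((mul_eq_zero.1 h2).resolve_left hj))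

theorem mem_lowOp_iff_finrank {k : ℕ} (hk : k + 1 < min m n) {z : BipartiteOp m n} (hz0 : z ≠ 0)
    (hz : z ∈ lowOp m n (k + 1)) :
    z ∈ lowOp m n k ↔ finrank ℂ ((Fin m × Fin n → ℂ) × (Fin m × Fin n → ℂ)) ≤
      finrank ℂ (lineSpan (k + 1) z) + 1 := by
  constructor
  · rintro ⟨x, hx, y, hy, rfl⟩
    obtain ⟨hx0, hy0⟩ := vecMulVec_ne_zero_iff.1 hz0
    rw [← finrank_range_segreDiff hx0 hy0]
    exact Nat.add_le_add_right (Submodule.finrank_mono (range_segreDiff_le hx hy)) 1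
  · obtain ⟨x, hx, y, hy, rfl⟩ := hz
    obtain ⟨hx0, hy0⟩ := vecMulVec_ne_zero_iff.1 hz0
    intro h
    have hx' : x ∈ lowSchmidt m n k := by
      by_contra hxk
      have h1 := finrank_lineSpan_lt hk hx
        (fun l hl hxl => hxk (mem_lowSchmidt_mono (Nat.lt_succ_iff.1 hl) hxl)) hx0 hy0
      have h2 := finrank_range_segreDiff hx0 hy0
      omega
    have hy' : y ∈ lowSchmidt m n k := by
      by_contra hyk
      have h1 := finrank_lineSpan_lt hk hy
        (fun l hl hyl => hyk (mem_lowSchmidt_mono (Nat.lt_succ_iff.1 hl) hyl)) hy0 hx0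
      have h2 := finrank_range_segreDiff hy0 hx0
      -- Transposition exchanges `x` and `y` and preserves the dimension of `lineSpan`, which
      -- reduces the claim on `y` to the one on `x`.
      have h3 := IsElementary.isLowUnitary (IsElementary.transpose (k := k + 1) (m := m) (n := n))
      have h4 := finrank_lineSpan_map h3.injective h3.mem_iff (vecMulVec x y)
      rw [show transposeMap m n (vecMulVec x y) = vecMulVec y x from transpose_vecMulVec _ _] at h4
      omega
    exact ⟨x, hx', y, hy', rfl⟩

theorem lowOp_mono {k l : ℕ} (h : k ≤ l) : lowOp m n k ⊆ lowOp m n l := by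
  rintro _ ⟨x, hx, y, hy, rfl⟩
  exact ⟨x, mem_lowSchmidt_mono h hx, y, mem_lowSchmidt_mono h hy, rfl⟩

/-- A map that preserves `lowOp` for some bound on the Schmidt rank preserves it for all smaller
bounds. -/
theorem map_mem_lowOp_of_le {k l : ℕ} (hl : l ≤ k) (hk : k < min m n)
    {Ψ : Module.End ℂ (BipartiteOp m n)} (hinj : Function.Injective Ψ)
    (hmem : ∀ z, Ψ z ∈ lowOp m n k ↔ z ∈ lowOp m n k) :
    ∀ z, Ψ z ∈ lowOp m n l ↔ z ∈ lowOp m n l := by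
  induction k, hl using Nat.le_induction with
  | base => exact hmem
  | succ k hlk ih =>
    refine ih (by omega) fun z => ?_
    by_cases hz0 : z = 0
    · simp [hz0, zero_mem_lowOp]
    have hz0' : Ψ z ≠ 0 := by simpa [map_eq_zero_iff Ψ hinj] using hz0
    by_cases hz : z ∈ lowOp m n (k + 1)
    · rw [mem_lowOp_iff_finrank hk hz0 hz, mem_lowOp_iff_finrank hk hz0' ((hmem z).2 hz),
        finrank_lineSpan_map hinj hmem]
    · exact iff_of_false (fun h => hz ((hmem z).1 (lowOp_mono k.le_succ h)))
        fun h => hz (lowOp_mono k.le_succ h)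

end SchmidtIsometry

/-! ### Product operators as tensors with four factors, and the action of the elementary maps on the
factors. -/

namespace SchmidtIsometry

open Matrix Module Function

variable {m n : ℕ}

/-- The product vector `a ⊗ b`. -/
def prodVec (a : Fin m → ℂ) (b : Fin n → ℂ) : Fin m × Fin n → ℂ := fun p => a p.1 * b p.2

theorem coeffMatrix_prodVec (a : Fin m → ℂ) (b : Fin n → ℂ) :
    coeffMatrix (prodVec a b) = vecMulVec a b := rfl

theorem prodVec_ne_zero {a : Fin m → ℂ} {b : Fin n → ℂ} (ha : a ≠ 0) (hb : b ≠ 0) :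
    prodVec a b ≠ 0 := fun h =>
  vecMulVec_ne_zero_iff.2 ⟨ha, hb⟩ (by rw [← coeffMatrix_prodVec, h, map_zero])

theorem parallel_of_prodVec_eq_smul {a a' : Fin m → ℂ} {b b' : Fin n → ℂ} (ha : a' ≠ 0)
    (hb : b' ≠ 0) {c : ℂ} (h : prodVec a' b' = c • prodVec a b) :
    (∃ d : ℂ, a' = d • a) ∧ ∃ d : ℂ, b' = d • b := by
  have h1 := congrArg coeffMatrix h
  rw [map_smul, coeffMatrix_prodVec, coeffMatrix_prodVec, ← smul_vecMulVec] at h1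
  obtain ⟨d, -, h2, h3⟩ := parallel_of_vecMulVec_eq ha hb h1.symm
  exact ⟨⟨d * c, by rw [h2, smul_smul]⟩, ⟨_, h3⟩⟩

theorem kronecker_mulVec_prodVec (A : Matrix (Fin m) (Fin m) ℂ) (B : Matrix (Fin n) (Fin n) ℂ)
    (a : Fin m → ℂ) (b : Fin n → ℂ) :
    (A ⊗ₖ B) *ᵥ prodVec a b = prodVec (A *ᵥ a) (B *ᵥ b) := by
  funext ⟨i, j⟩
  simp only [prodVec, mulVec, dotProduct, kroneckerMap_apply, Fintype.sum_prod_type,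
    Finset.sum_mul_sum]
  exact Finset.sum_congr rfl fun _ _ => Finset.sum_congr rfl fun _ _ => by ring

theorem norm_toLp_prodVec (a : Fin m → ℂ) (b : Fin n → ℂ) :
    ‖(WithLp.toLp 2 (prodVec a b) : BipartiteVec m n)‖ =
      ‖(WithLp.toLp 2 a : EuclideanSpace ℂ (Fin m))‖ *
        ‖(WithLp.toLp 2 b : EuclideanSpace ℂ (Fin n))‖ := by
  rw [EuclideanSpace.norm_eq, EuclideanSpace.norm_eq, EuclideanSpace.norm_eq,
    ← Real.sqrt_mul (Finset.sum_nonneg fun _ _ => sq_nonneg _), Finset.sum_mul_sum,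
    Fintype.sum_prod_type]
  simp [prodVec, mul_pow]

/-- The dimension of a tensor factor of `|w⟩⟨y|`; the first index tells the ket from the bra, the
second one the two parties. -/
abbrev legDim (m n : ℕ) (i : Bool × Bool) : ℕ := bif i.2 then n else m

/-- The tensor factors of the space of operators. -/
abbrev Leg (m n : ℕ) (i : Bool × Bool) : Type := Fin (legDim m n i) → ℂ

/-- The families of vectors with given members. -/
def legs (a : Fin m → ℂ) (b : Fin n → ℂ) (c : Fin m → ℂ) (d : Fin n → ℂ) :
    ∀ i : Bool × Bool, Leg m n i
  | (false, false) => a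
  | (false, true) => b
  | (true, false) => c
  | (true, true) => d

/-- The operator `|a ⊗ b⟩⟨c ⊗ d|`, without conjugation, as a multilinear map. -/
def tensor (m n : ℕ) : MultilinearMap ℂ (Leg m n) (BipartiteOp m n) :=
  MultilinearMap.mk'
    (fun v => vecMulVec (prodVec (v (false, false)) (v (false, true)))
      (prodVec (v (true, false)) (v (true, true))))
    (by
      rintro v ⟨_ | _, _ | _⟩ x y <;> ext p q <;>
        simp [vecMulVec_apply, prodVec] <;> ring)
    (by
      rintro v ⟨_ | _, _ | _⟩ c x <;> ext p q <;>
        simp [vecMulVec_apply, prodVec] <;> ring)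

theorem tensor_apply (v : ∀ i, Leg m n i) :
    tensor m n v = vecMulVec (prodVec (v (false, false)) (v (false, true)))
      (prodVec (v (true, false)) (v (true, true))) := rfl

theorem exists_eq_smul_of_vecMulVec_eq {α β : Type*} {x A : α → ℂ} {y B : β → ℂ} (hx : x ≠ 0)
    (h : vecMulVec x y = vecMulVec A B) : ∃ d : ℂ, y = d • B := by
  obtain ⟨i, hi⟩ := Function.ne_iff.1 hx
  have hi' : x i ≠ 0 := hi
  refine ⟨A i / x i, funext fun j => ?_⟩
  have : x i * y j = A i * B j := congrFun (congrFun h i) j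
  simp only [Pi.smul_apply, smul_eq_mul]
  field_simp
  linear_combination this

theorem parallel_or_of_prodVec_add {a a' A : Fin m → ℂ} {b b' B : Fin n → ℂ} (ha : a ≠ 0)
    (hb : b ≠ 0) {c d : ℂ} (hc : c ≠ 0)
    (h : prodVec a b + c • prodVec a' b' = d • prodVec A B) :
    (∃ e : ℂ, a' = e • a) ∨ ∃ e : ℂ, b' = e • b := by
  have h1 := congrArg coeffMatrix h
  rw [map_add, map_smul, map_smul, coeffMatrix_prodVec, coeffMatrix_prodVec, coeffMatrix_prodVec,
    ← smul_vecMulVec, ← smul_vecMulVec] at h1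
  rcases parallel_or_of_vecMulVec_add ha hb h1 with ⟨e, he⟩ | h2
  · exact Or.inl ⟨c⁻¹ * e, by rw [mul_smul, ← he, smul_smul, inv_mul_cancel₀ hc, one_smul]⟩
  · exact Or.inr h2

/-- The rank-one criterion is applied twice: between ket and bra, then to the two factors of the
side that is not yet known to be parallel. -/
theorem isSegre_tensor : IsSegre (tensor m n) where
  ne_zero v hv := by
    rw [tensor_apply]
    exact vecMulVec_ne_zero_iff.2 ⟨prodVec_ne_zero (hv _) (hv _), prodVec_ne_zero (hv _) (hv _)⟩
  exists_of_add v w u hv hw h := by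
    rw [tensor_apply, tensor_apply, tensor_apply] at h
    have hv0 := prodVec_ne_zero (hv (false, false)) (hv (false, true))
    have hv1 := prodVec_ne_zero (hv (true, false)) (hv (true, true))
    rcases parallel_or_of_vecMulVec_add hv0 hv1 h with ⟨c, hc⟩ | ⟨c, hc⟩
    · obtain ⟨h0, h1⟩ := parallel_of_prodVec_eq_smul (hw (false, false)) (hw (false, true)) hc
      have hc0 : c ≠ 0 := by
        rintro rfl
        rw [zero_smul] at hc
        exact prodVec_ne_zero (hw (false, false)) (hw (false, true)) hc
      rw [hc, smul_vecMulVec, ← vecMulVec_smul, ← vecMulVec_add] at h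
      obtain ⟨d, hd⟩ := exists_eq_smul_of_vecMulVec_eq hv0 h
      rcases parallel_or_of_prodVec_add (hv (true, false)) (hv (true, true)) hc0 hd with h2 | h2
      · refine ⟨(true, true), ?_⟩
        rintro ⟨_ | _, _ | _⟩ hl
        exacts [h0, h1, h2, absurd rfl hl]
      · refine ⟨(true, false), ?_⟩
        rintro ⟨_ | _, _ | _⟩ hl
        exacts [h0, h1, absurd rfl hl, h2]
    · obtain ⟨h0, h1⟩ := parallel_of_prodVec_eq_smul (hw (true, false)) (hw (true, true)) hc
      have hc0 : c ≠ 0 := by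
        rintro rfl
        rw [zero_smul] at hc
        exact prodVec_ne_zero (hw (true, false)) (hw (true, true)) hc
      rw [hc, vecMulVec_smul, ← smul_vecMulVec, ← add_vecMulVec] at h
      have h' := congrArg Matrix.transpose h
      rw [transpose_vecMulVec, transpose_vecMulVec] at h'
      obtain ⟨d, hd⟩ := exists_eq_smul_of_vecMulVec_eq hv1 h'
      rcases parallel_or_of_prodVec_add (hv (false, false)) (hv (false, true)) hc0 hd with h2 | h2
      · refine ⟨(false, true), ?_⟩
        rintro ⟨_ | _, _ | _⟩ hl
        exacts [h2, absurd rfl hl, h0, h1]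
      · refine ⟨(false, false), ?_⟩
        rintro ⟨_ | _, _ | _⟩ hl
        exacts [absurd rfl hl, h2, h0, h1]

theorem mem_lowOp_one_iff {z : BipartiteOp m n} : z ∈ lowOp m n 1 ↔ ∃ v, z = tensor m n v := by
  constructor
  · rintro ⟨w, hw, y, hy, rfl⟩
    obtain ⟨a, b, rfl⟩ := exists_of_mem_lowSchmidt_one hw
    obtain ⟨c, d, rfl⟩ := exists_of_mem_lowSchmidt_one hy
    exact ⟨legs a b c d, rfl⟩
  · rintro ⟨v, rfl⟩
    exact ⟨_, prod_mem_lowSchmidt le_rfl _ _, _, prod_mem_lowSchmidt le_rfl _ _, rfl⟩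

theorem norm_tensor (v : ∀ i, Leg m n i) :
    ‖toHilbert m n (tensor m n v)‖ =
      ∏ i, ‖(WithLp.toLp 2 (v i) : EuclideanSpace ℂ (Fin (legDim m n i)))‖ := by
  rw [tensor_apply, norm_toHilbert_vecMulVec, norm_toLp_prodVec, norm_toLp_prodVec,
    Fintype.prod_prod_type, Fintype.prod_bool, Fintype.prod_bool, Fintype.prod_bool]
  ring

/-- Matrix units are product tensors. -/
theorem ext_of_tensor {g : Module.End ℂ (BipartiteOp m n)}
    (h : ∀ v, g (tensor m n v) = tensor m n v) (z : BipartiteOp m n) : g z = z := by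
  suffices g = LinearMap.id by rw [this, LinearMap.id_apply]
  refine Matrix.ext_linearMap ℂ fun p q => LinearMap.ext_ring ?_
  have hs : Matrix.single p q (1 : ℂ) = tensor m n (legs (Pi.single p.1 1) (Pi.single p.2 1)
      (Pi.single q.1 1) (Pi.single q.2 1)) := by
    ext i j
    simp only [tensor_apply, legs, vecMulVec_apply, prodVec, Matrix.single_apply, Pi.single_apply,
      Prod.ext_iff]
    split_ifs <;> simp_all
  change g (Matrix.single p q 1) = Matrix.single p q 1
  rw [hs, h]

theorem mulLeftRight_tensor (A C : Matrix (Fin m) (Fin m) ℂ) (B D : Matrix (Fin n) (Fin n) ℂ)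
    (v : ∀ i, Leg m n i) :
    mulLeftRight (A ⊗ₖ B) (Cᵀ ⊗ₖ Dᵀ) (tensor m n v) =
      tensor m n (legs (A *ᵥ v (false, false)) (B *ᵥ v (false, true)) (C *ᵥ v (true, false))
        (D *ᵥ v (true, true))) := by
  rw [show ∀ X, mulLeftRight (A ⊗ₖ B) (Cᵀ ⊗ₖ Dᵀ) X = (A ⊗ₖ B) * X * (Cᵀ ⊗ₖ Dᵀ) from
    fun _ => rfl, tensor_apply, tensor_apply, mul_vecMulVec, vecMulVec_mul, kroneckerMap_transpose,
    vecMul_transpose, kronecker_mulVec_prodVec, kronecker_mulVec_prodVec]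
  rfl

/-- The map `g` sends lines of product operators in the direction of the factor `j` to lines in the
direction of the factor `π j`. -/
def PermutesLegs (g : Module.End ℂ (BipartiteOp m n)) (π : Bool × Bool → Bool × Bool) : Prop :=
  ∃ F : (∀ i, Leg m n i) → ∀ i, Leg m n i, (∀ v, g (tensor m n v) = tensor m n (F v)) ∧
    ∀ r j s, ∀ l ≠ π j, F (update r j s) l = F r l

theorem permutesLegs_transposeMap :
    PermutesLegs (transposeMap m n) fun i => (!i.1, i.2) := by
  refine ⟨fun v => legs (v (true, false)) (v (true, true)) (v (false, false)) (v (false, true)),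
    fun v => transpose_vecMulVec _ _, ?_⟩
  rintro r ⟨_ | _, _ | _⟩ s ⟨_ | _, _ | _⟩ hl <;> simp_all [legs]

theorem permutesLegs_partialTransposeMap :
    PermutesLegs (partialTransposeMap m n) fun i => (bif i.2 then !i.1 else i.1, i.2) := by
  refine ⟨fun v => legs (v (false, false)) (v (true, true)) (v (true, false)) (v (false, true)),
    fun v => ?_, ?_⟩
  · ext p q
    rw [show ∀ z : BipartiteOp m n, partialTransposeMap m n z p q = z (p.1, q.2) (q.1, p.2) from
      fun _ => rfl]
    simp only [tensor_apply, vecMulVec_apply, prodVec, legs]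
    ring
  · rintro r ⟨_ | _, _ | _⟩ s ⟨_ | _, _ | _⟩ hl <;> simp_all [legs]

theorem isLocalUnitary_one : IsLocalUnitary (1 : BipartiteOp m n) :=
  Or.inl ⟨1, one_mem _, 1, one_mem _, one_kronecker_one.symm⟩

theorem isLocalUnitary_swapOp (h : n = m) : IsLocalUnitary (swapOp h) :=
  Or.inr ⟨h, 1, one_mem _, 1, one_mem _, by rw [one_kronecker_one, Matrix.mul_one]⟩

theorem swapOp_mulVec_prodVec (a b : Fin n → ℂ) :
    swapOp (rfl : n = n) *ᵥ prodVec a b = prodVec b a := by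
  rw [swapOp_mulVec]
  funext p
  exact mul_comm _ _

theorem exists_permutesLegs_swap_left (k : ℕ) (h : n = m) :
    ∃ g, IsElementary k m n g ∧ PermutesLegs g fun i => (i.1, bif i.1 then i.2 else !i.2) := by
  refine ⟨mulLeftRight (swapOp h) 1, .mul _ _ (isLocalUnitary_swapOp h) isLocalUnitary_one, ?_⟩
  subst h
  refine ⟨fun v => legs (v (false, true)) (v (false, false)) (v (true, false)) (v (true, true)),
    fun v => ?_, ?_⟩
  · rw [show ∀ X, mulLeftRight (swapOp rfl) 1 X = swapOp (rfl : n = n) * X * 1 from fun _ => rfl,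
      Matrix.mul_one, tensor_apply, tensor_apply, mul_vecMulVec]
    congr 1
    exact swapOp_mulVec_prodVec _ _
  · rintro r ⟨_ | _, _ | _⟩ s ⟨_ | _, _ | _⟩ hl <;> simp_all [legs]

theorem exists_permutesLegs_swap_right (k : ℕ) (h : n = m) :
    ∃ g, IsElementary k m n g ∧ PermutesLegs g fun i => (i.1, bif i.1 then !i.2 else i.2) := by
  refine ⟨mulLeftRight 1 (swapOp h), .mul _ _ isLocalUnitary_one (isLocalUnitary_swapOp h), ?_⟩
  subst h
  refine ⟨fun v => legs (v (false, false)) (v (false, true)) (v (true, true)) (v (true, false)),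
    fun v => ?_, ?_⟩
  · rw [show ∀ X, mulLeftRight 1 (swapOp rfl) X = 1 * X * swapOp (rfl : n = n) from fun _ => rfl,
      Matrix.one_mul, tensor_apply, tensor_apply, vecMulVec_mul, ← mulVec_transpose,
      swapOp_transpose]
    congr 1
    exact swapOp_mulVec_prodVec _ _
  · rintro r ⟨_ | _, _ | _⟩ s ⟨_ | _, _ | _⟩ hl <;> simp_all [legs]

end SchmidtIsometry

/-! ### Aligning the four directions, and the conclusion. -/

namespace SchmidtIsometry

open Matrix Module Function

variable {m n k : ℕ} {Ψ : Module.End ℂ (BipartiteOp m n)} {e : ∀ i, Leg m n i}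
  {σ : Bool × Bool → Bool × Bool}

/-- Injective linear maps that preserve `lowOp` and the Hilbert–Schmidt norm of its elements. -/
structure IsLowPreserver (k : ℕ) (Ψ : Module.End ℂ (BipartiteOp m n)) : Prop where
  injective : Injective Ψ
  mem_iff : ∀ z, Ψ z ∈ lowOp m n k ↔ z ∈ lowOp m n k
  norm_map : ∀ z ∈ lowOp m n k, ‖toHilbert m n (Ψ z)‖ = ‖toHilbert m n z‖

theorem IsLowPreserver.mul {g : Module.End ℂ (BipartiteOp m n)} (hg : IsLowUnitary k g)
    (hΨ : IsLowPreserver k Ψ) : IsLowPreserver k (g * Ψ) where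
  injective := hg.injective.comp hΨ.injective
  mem_iff z := by rw [Module.End.mul_apply, hg.mem_iff, hΨ.mem_iff]
  norm_map z hz := by rw [Module.End.mul_apply, hg.norm_map, hΨ.norm_map z hz]

theorem IsLowPreserver.exists_tensor (hΨ : IsLowPreserver k Ψ) (hk : 1 ≤ k) (hkmn : k < min m n)
    (v : ∀ i, Leg m n i) : ∃ r, Ψ (tensor m n v) = tensor m n r :=
  mem_lowOp_one_iff.1 ((map_mem_lowOp_of_le hk hkmn hΨ.injective hΨ.mem_iff _).2
    (mem_lowOp_one_iff.2 ⟨v, rfl⟩))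

/-- `Ψ` sends the line of product operators through `e` in the direction `i` to a line in the
direction `σ i`. -/
def HasDirections (Ψ : Module.End ℂ (BipartiteOp m n)) (e : ∀ i, Leg m n i)
    (σ : Bool × Bool → Bool × Bool) : Prop :=
  ∀ i, ∃ r, ∀ u, ∃ s, Ψ (tensor m n (update e i u)) = tensor m n (update r (σ i) s)

theorem HasDirections.mul (h : HasDirections Ψ e σ) {g : Module.End ℂ (BipartiteOp m n)}
    {π : Bool × Bool → Bool × Bool} (hg : PermutesLegs g π) :
    HasDirections (g * Ψ) e fun i => π (σ i) := by
  obtain ⟨F, hF, hF'⟩ := hg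
  intro i
  obtain ⟨r, hr⟩ := h i
  refine ⟨F r, fun u => ?_⟩
  obtain ⟨s, hs⟩ := hr u
  refine ⟨F (update r (σ i) s) (π (σ i)), ?_⟩
  rw [Module.End.mul_apply, hs, hF]
  congr 1
  rw [eq_update_iff]
  exact ⟨rfl, fun l hl => hF' r (σ i) s l hl⟩

theorem ne_zero_of_map_tensor (hinj : Injective Ψ) (he : ∀ i, e i ≠ 0) {r : ∀ i, Leg m n i}
    (hr : Ψ (tensor m n e) = tensor m n r) (i) : r i ≠ 0 := by
  refine ne_zero_of_map_ne_zero (τ := tensor m n) ?_ i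
  rw [← hr]
  exact fun h => isSegre_tensor.ne_zero e he (hinj (by rw [h, map_zero]))

/-- The lines in a given direction may be based at the same point. -/
theorem HasDirections.exists_update (h : HasDirections Ψ e σ) (hinj : Injective Ψ)
    (he : ∀ i, e i ≠ 0) {r : ∀ i, Leg m n i} (hr : Ψ (tensor m n e) = tensor m n r) (i)
    (u : Leg m n i) : ∃ s, Ψ (tensor m n (update e i u)) = tensor m n (update r (σ i) s) := by
  obtain ⟨t, ht⟩ := h i
  obtain ⟨s₀, hs₀⟩ := ht (e i)
  rw [update_eq_self] at hs₀
  have ht0 := ne_zero_of_map_tensor hinj he hs₀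
  have hr0 := ne_zero_of_map_tensor hinj he hr
  have hpar : ∀ l ≠ σ i, ∃ c : ℂ, t l = c • r l := by
    intro l hl
    have := isSegre_tensor.parallel_of_eq_smul hr0 ht0 (a := 1) (by rw [one_smul, ← hs₀, hr]) l
    rwa [update_of_ne hl] at this
  obtain ⟨C, hC⟩ := exists_smul_of_parallel (τ := tensor m n) hpar
  obtain ⟨s, hs⟩ := ht u
  exact ⟨C • s, by rw [hs, hC, MultilinearMap.map_update_smul]⟩

/-- The action on the lines in a given direction is linear. -/
theorem HasDirections.exists_linearMap (h : HasDirections Ψ e σ) (hinj : Injective Ψ)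
    (he : ∀ i, e i ≠ 0) {r : ∀ i, Leg m n i} (hr : Ψ (tensor m n e) = tensor m n r) (i) :
    ∃ L : Leg m n i →ₗ[ℂ] Leg m n (σ i),
      ∀ u, Ψ (tensor m n (update e i u)) = tensor m n (update r (σ i) (L u)) := by
  choose s hs using h.exists_update hinj he hr i
  have hr0 := ne_zero_of_map_tensor hinj he hr
  have huniq : ∀ x y, tensor m n (update r (σ i) x) = tensor m n (update r (σ i) y) → x = y := by
    intro x y hxy
    refine sub_eq_zero.1 (isSegre_tensor.eq_zero_of_update hr0 (j := σ i) ?_)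
    rw [MultilinearMap.map_update_sub, hxy, sub_self]
  refine ⟨⟨⟨s, fun x y => huniq _ _ ?_⟩, fun c x => huniq _ _ ?_⟩, hs⟩
  · rw [MultilinearMap.map_update_add, ← hs, ← hs, ← hs, MultilinearMap.map_update_add, map_add]
  · rw [RingHom.id_apply, MultilinearMap.map_update_smul]
    change tensor m n (update r (σ i) (s (c • x))) = _
    rw [← hs, ← hs, MultilinearMap.map_update_smul, map_smul]

theorem not_parallel_of_map {i j : Bool × Bool} {r : ∀ i, Leg m n i} (hinj : Injective Ψ)
    (he : ∀ i, e i ≠ 0) (hr : Ψ (tensor m n e) = tensor m n r) {u : Leg m n i} {s : Leg m n j}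
    (hu : ¬∃ c : ℂ, u = c • e i)
    (h : Ψ (tensor m n (update e i u)) = tensor m n (update r j s)) : ¬∃ c : ℂ, s = c • r j := by
  rintro ⟨c, rfl⟩
  have hu0 : u ≠ 0 := fun h0 => hu ⟨0, by rw [h0, zero_smul]⟩
  rw [MultilinearMap.map_update_smul, update_eq_self, ← hr, ← map_smul] at h
  have h1 := isSegre_tensor.parallel_of_eq_smul he (update_ne_zero he hu0) (hinj h) i
  rw [update_self] at h1
  exact hu h1

/-- Two perturbations of one product operator in factors on different sides do not add up to an
operator of rank one. -/
theorem add_ne_vecMulVec {r : ∀ i, Leg m n i} (hr : ∀ i, r i ≠ 0) {b b' : Bool}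
    {s : Leg m n (false, b)} {s' : Leg m n (true, b')} (hs : ¬∃ c : ℂ, s = c • r (false, b))
    (hs' : ¬∃ c : ℂ, s' = c • r (true, b')) (X Y : Fin m × Fin n → ℂ) :
    tensor m n (update r (false, b) s) + tensor m n (update r (true, b') s') ≠ vecMulVec X Y := by
  intro h
  have hs0 : s ≠ 0 := fun h0 => hs ⟨0, by rw [h0, zero_smul]⟩
  have hs0' : s' ≠ 0 := fun h0 => hs' ⟨0, by rw [h0, zero_smul]⟩
  set p := update r (false, b) s with hp
  set q := update r (true, b') s' with hq
  have hp0 := update_ne_zero hr hs0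
  have hq0 := update_ne_zero hr hs0'
  have hpb : p (false, b) = s := update_self _ _ _
  have hqb : q (false, b) = r (false, b) := update_of_ne (by simp) _ _
  have hpb' : p (true, b') = r (true, b') := update_of_ne (by simp) _ _
  have hqb' : q (true, b') = s' := update_self _ _ _
  rw [tensor_apply, tensor_apply] at h
  rcases parallel_or_of_vecMulVec_add (prodVec_ne_zero (hp0 _) (hp0 _))
    (prodVec_ne_zero (hp0 _) (hp0 _)) h with ⟨c, hc⟩ | ⟨c, hc⟩
  · obtain ⟨h1, h2⟩ := parallel_of_prodVec_eq_smul (hq0 _) (hq0 _) hc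
    have h3 : ∃ d : ℂ, q (false, b) = d • p (false, b) := by
      cases b
      exacts [h1, h2]
    rw [hpb, hqb] at h3
    obtain ⟨d, hd⟩ := h3
    exact hs (parallel_symm (hr _) hd)
  · obtain ⟨h1, h2⟩ := parallel_of_prodVec_eq_smul (hq0 _) (hq0 _) hc
    have h3 : ∃ d : ℂ, q (true, b') = d • p (true, b') := by
      cases b'
      exacts [h1, h2]
    rw [hpb', hqb'] at h3
    exact hs' h3

section Preserver

variable (hΨ : IsLowPreserver k Ψ) (hk : 1 ≤ k) (hkmn : k < min m n) (he : ∀ i, e i ≠ 0)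
  (hf : ∀ i, ∃ f : Leg m n i, ¬∃ c : ℂ, f = c • e i)
include hΨ hk hkmn he hf

theorem exists_hasDirections : ∃ σ, HasDirections Ψ e σ := by
  obtain ⟨r, hr⟩ := hΨ.exists_tensor hk hkmn e
  choose σ hσ using fun i => isSegre_tensor.exists_direction hΨ.injective
    (hΨ.exists_tensor hk hkmn) he hr (hf i)
  exact ⟨σ, fun i => ⟨r, hσ i⟩⟩

variable (hσ : HasDirections Ψ e σ)
include hσ

/-- If two directions had the same image, points on the two image lines would add up to a product;
since `Ψ` also reflects products, so would their preimages, which differ in two factors. -/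
theorem HasDirections.injective : Injective σ := by
  intro i i' hii
  by_contra hne
  obtain ⟨r, hr⟩ := hΨ.exists_tensor hk hkmn e
  obtain ⟨f, hf1⟩ := hf i
  obtain ⟨f', hf1'⟩ := hf i'
  have hf0 : f ≠ 0 := fun h0 => hf1 ⟨0, by rw [h0, zero_smul]⟩
  have hf0' : f' ≠ 0 := fun h0 => hf1' ⟨0, by rw [h0, zero_smul]⟩
  obtain ⟨s, hs⟩ := hσ.exists_update hΨ.injective he hr i f
  obtain ⟨s', hs'⟩ : ∃ s', Ψ (tensor m n (update e i' f')) = tensor m n (update r (σ i) s') := by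
    rw [hii]
    exact hσ.exists_update hΨ.injective he hr i' f'
  obtain ⟨w, hw⟩ := mem_lowOp_one_iff.1 ((map_mem_lowOp_of_le hk hkmn hΨ.injective hΨ.mem_iff
    (tensor m n (update e i f) + tensor m n (update e i' f'))).1
    (mem_lowOp_one_iff.2 ⟨update r (σ i) (s + s'), by
      rw [map_add, hs, hs', MultilinearMap.map_update_add]⟩))
  obtain ⟨j, hj⟩ := isSegre_tensor.exists_of_add _ _ w (update_ne_zero he hf0)
    (update_ne_zero he hf0') hw
  by_cases hji : i' = j
  · have h1 := hj i (fun h => hne (h.trans hji.symm))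
    rw [update_self, update_of_ne hne] at h1
    obtain ⟨c, hc⟩ := h1
    exact hf1 (parallel_symm (he i) hc)
  · have h1 := hj i' hji
    rw [update_self, update_of_ne (Ne.symm hne)] at h1
    exact hf1' h1

/-- The linear action on each line is injective, so dimensions do not drop; as `σ` is a permutation,
their sum is unchanged and each inequality is an equality. -/
theorem HasDirections.legDim_eq (i) : legDim m n (σ i) = legDim m n i := by
  have hinj := hσ.injective hΨ hk hkmn he hf
  obtain ⟨r, hr⟩ := hΨ.exists_tensor hk hkmn e
  have hle : ∀ i, legDim m n i ≤ legDim m n (σ i) := by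
    intro i
    obtain ⟨L, hL⟩ := hσ.exists_linearMap hΨ.injective he hr i
    have hLinj : Injective L := by
      refine (injective_iff_map_eq_zero L).2 fun u hu => ?_
      have h1 := hL u
      rw [hu, MultilinearMap.map_update_zero] at h1
      exact isSegre_tensor.eq_zero_of_update he ((map_eq_zero_iff Ψ hΨ.injective).1 h1)
    have h2 := LinearMap.finrank_le_finrank_of_injective hLinj
    rwa [finrank_fin_fun, finrank_fin_fun] at h2
  have hsum : ∑ i, legDim m n i = ∑ i, legDim m n (σ i) :=
    ((Equiv.ofBijective σ (Finite.injective_iff_bijective.1 hinj)).sum_comp (legDim m n)).symm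
  exact (((Finset.sum_eq_sum_iff_of_le fun i _ => hle i).1 hsum) i (Finset.mem_univ i)).symm

/-- Perturbing the two ket factors separately and adding gives an operator of rank one whose ket has
Schmidt rank at most 2. For `k ≥ 2` its image must have rank at most one, which fails if the two
directions end up on different sides. This excludes the partial transpose. -/
theorem HasDirections.fst_eq (hk2 : 2 ≤ k) : (σ (false, false)).1 = (σ (false, true)).1 := by
  obtain ⟨r, hr⟩ := hΨ.exists_tensor hk hkmn e
  have hr0 := ne_zero_of_map_tensor hΨ.injective he hr
  obtain ⟨f, hf1⟩ := hf (false, false)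
  obtain ⟨f', hf1'⟩ := hf (false, true)
  obtain ⟨s, hs⟩ := hσ.exists_update hΨ.injective he hr _ f
  obtain ⟨s', hs'⟩ := hσ.exists_update hΨ.injective he hr _ f'
  have h1 := not_parallel_of_map hΨ.injective he hr hf1 hs
  have h1' := not_parallel_of_map hΨ.injective he hr hf1' hs'
  have hmem : tensor m n (update e (false, false) f) + tensor m n (update e (false, true) f') ∈
      lowOp m n 2 := by
    refine ⟨prodVec f (e (false, true)) + prodVec (e (false, false)) f', ?_,
      prodVec (e (true, false)) (e (true, true)), prod_mem_lowSchmidt one_le_two _ _, ?_⟩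
    · rw [mem_lowSchmidt, map_add]
      exact (rank_add_le _ _).trans (show _ ≤ 1 + 1 from
        add_le_add (prod_mem_lowSchmidt le_rfl _ _) (prod_mem_lowSchmidt le_rfl _ _))
    · rw [add_vecMulVec]
      rfl
  obtain ⟨X, -, Y, -, hXY⟩ :=
    (map_mem_lowOp_of_le hk2 hkmn hΨ.injective hΨ.mem_iff _).2 hmem
  rw [map_add, hs, hs'] at hXY
  generalize σ (false, false) = j at *
  generalize σ (false, true) = j' at *
  obtain ⟨a, b⟩ := j
  obtain ⟨a', b'⟩ := j'
  cases a <;> cases a'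
  · rfl
  · exact absurd hXY (add_ne_vecMulVec hr0 h1 h1' X Y)
  · rw [add_comm] at hXY
    exact absurd hXY (add_ne_vecMulVec hr0 h1' h1 X Y)
  · rfl

end Preserver

/-- Some composition of elementary maps straightens the directions of `Ψ`. -/
def IsAlignable (k : ℕ) (e : ∀ i, Leg m n i) (Ψ : Module.End ℂ (BipartiteOp m n)) : Prop :=
  ∃ g, IsCompositionOfElementary k m n g ∧ HasDirections (g * Ψ) e fun i => i

theorem IsAlignable.of_mul {g : Module.End ℂ (BipartiteOp m n)} (hg : IsElementary k m n g)
    (h : IsAlignable k e (g * Ψ)) : IsAlignable k e Ψ := by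
  obtain ⟨g', hg', hd⟩ := h
  exact ⟨g' * g, mul_mem hg' (Subsemigroup.subset_closure hg), by rwa [mul_assoc]⟩

theorem isElementary_one : IsElementary k m n 1 := by
  have h : (1 : Module.End ℂ (BipartiteOp m n)) = mulLeftRight 1 1 := by
    ext1 X
    change X = 1 * X * 1
    rw [Matrix.one_mul, Matrix.mul_one]
  rw [h]
  exact .mul _ _ isLocalUnitary_one isLocalUnitary_one

section Align

variable (hk : 1 ≤ k) (hkmn : k < min m n) (he : ∀ i, e i ≠ 0)
  (hf : ∀ i, ∃ f : Leg m n i, ¬∃ c : ℂ, f = c • e i)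
include hk hkmn he hf

/-- With the ket factors in place, the bra factors can only be exchanged; equality of dimensions
then gives `n = m`, and a swap on the right undoes it. -/
theorem isAlignable_of_fix_two (hΨ : IsLowPreserver k Ψ) (hσ : HasDirections Ψ e σ)
    (h0 : σ (false, false) = (false, false)) (h1 : σ (false, true) = (false, true)) :
    IsAlignable k e Ψ := by
  have hinj := hσ.injective hΨ hk hkmn he hf
  have hd := hσ.legDim_eq hΨ hk hkmn he hf
  have n1 : σ (true, false) ≠ σ (false, false) := hinj.ne (by simp)
  have n2 : σ (true, false) ≠ σ (false, true) := hinj.ne (by simp)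
  have n3 : σ (true, true) ≠ σ (false, false) := hinj.ne (by simp)
  have n4 : σ (true, true) ≠ σ (false, true) := hinj.ne (by simp)
  have n5 : σ (true, true) ≠ σ (true, false) := hinj.ne (by simp)
  have hd0 := hd (true, false)
  rw [h0] at n1 n3
  rw [h1] at n2 n4
  rcases h2 : σ (true, false) with ⟨_ | _, _ | _⟩
  · exact absurd h2 n1
  · exact absurd h2 n2
  · refine ⟨1, Subsemigroup.subset_closure isElementary_one, ?_⟩
    rcases h3 : σ (true, true) with ⟨_ | _, _ | _⟩
    · exact absurd h3 n3
    · exact absurd h3 n4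
    · exact absurd (h3.trans h2.symm) n5
    · rw [one_mul]
      convert hσ using 1
      funext i
      rcases i with ⟨_ | _, _ | _⟩ <;> simp [h0, h1, h2, h3]
  · rw [h2] at hd0
    obtain ⟨g, hg, hgp⟩ := exists_permutesLegs_swap_right (m := m) (n := n) k hd0
    refine ⟨g, Subsemigroup.subset_closure hg, ?_⟩
    convert hσ.mul hgp using 1
    rcases h3 : σ (true, true) with ⟨_ | _, _ | _⟩
    · exact absurd h3 n3
    · exact absurd h3 n4
    · funext i
      rcases i with ⟨_ | _, _ | _⟩ <;> simp [h0, h1, h2, h3]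
    · exact absurd (h3.trans h2.symm) n5

theorem isAlignable_of_fix_of_eq (hΨ : IsLowPreserver k Ψ) (hσ : HasDirections Ψ e σ)
    (h0 : σ (false, false) = (false, false)) (h1 : σ (false, true) = (true, true)) :
    IsAlignable k e Ψ := by
  have hk1 : k = 1 := by
    by_contra hk1
    have := hσ.fst_eq hΨ hk hkmn he hf (by omega)
    rw [h0, h1] at this
    exact Bool.false_ne_true this
  have hg : IsElementary k m n (partialTransposeMap m n) := .partialTranspose hk1
  refine IsAlignable.of_mul hg (isAlignable_of_fix_two hk hkmn he hf (hΨ.mul hg.isLowUnitary)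
    (hσ.mul permutesLegs_partialTransposeMap) ?_ ?_)
  · simp [h0]
  · simp [h1]

/-- If the second ket factor goes to the bra factor of the first party, then `n = m` and a swap on
the right brings it to the second party, where partial transposition returns it to the ket. -/
theorem isAlignable_of_fix (hΨ : IsLowPreserver k Ψ) (hσ : HasDirections Ψ e σ)
    (h0 : σ (false, false) = (false, false)) : IsAlignable k e Ψ := by
  have hne : σ (false, true) ≠ σ (false, false) :=
    (hσ.injective hΨ hk hkmn he hf).ne (by simp)
  have hd := hσ.legDim_eq hΨ hk hkmn he hf (false, true)
  rcases h1 : σ (false, true) with ⟨_ | _, _ | _⟩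
  · exact absurd (h1.trans h0.symm) hne
  · exact isAlignable_of_fix_two hk hkmn he hf hΨ hσ h0 h1
  · rw [h1] at hd
    obtain ⟨g, hg, hgp⟩ := exists_permutesLegs_swap_right (m := m) (n := n) k hd.symm
    refine IsAlignable.of_mul hg (isAlignable_of_fix_of_eq hk hkmn he hf
      (hΨ.mul hg.isLowUnitary) (hσ.mul hgp) ?_ ?_)
    · simp [h0]
    · simp [h1]
  · exact isAlignable_of_fix_of_eq hk hkmn he hf hΨ hσ h0 h1

theorem isAlignable_of_left (hΨ : IsLowPreserver k Ψ) (hσ : HasDirections Ψ e σ)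
    (h0 : (σ (false, false)).1 = false) : IsAlignable k e Ψ := by
  have hd := hσ.legDim_eq hΨ hk hkmn he hf (false, false)
  rcases h1 : σ (false, false) with ⟨_ | _, _ | _⟩
  · exact isAlignable_of_fix hk hkmn he hf hΨ hσ h1
  · rw [h1] at hd
    obtain ⟨g, hg, hgp⟩ := exists_permutesLegs_swap_left (m := m) (n := n) k hd
    refine IsAlignable.of_mul hg (isAlignable_of_fix hk hkmn he hf
      (hΨ.mul hg.isLowUnitary) (hσ.mul hgp) ?_)
    simp [h1]
  · simp [h1] at h0
  · simp [h1] at h0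

theorem IsLowPreserver.isAlignable (hΨ : IsLowPreserver k Ψ) : IsAlignable k e Ψ := by
  obtain ⟨σ, hσ⟩ := exists_hasDirections hΨ hk hkmn he hf
  by_cases h0 : (σ (false, false)).1 = false
  · exact isAlignable_of_left hk hkmn he hf hΨ hσ h0
  · have hg : IsElementary k m n (transposeMap m n) := .transpose
    refine IsAlignable.of_mul hg (isAlignable_of_left hk hkmn he hf (hΨ.mul hg.isLowUnitary)
      (hσ.mul permutesLegs_transposeMap) ?_)
    simpa using h0

end Align

theorem toMatrix'_mem_unitaryGroup {a : ℕ} {L : (Fin a → ℂ) →ₗ[ℂ] (Fin a → ℂ)}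
    (hL : ∀ u, ‖(WithLp.toLp 2 (L u) : EuclideanSpace ℂ (Fin a))‖ =
      ‖(WithLp.toLp 2 u : EuclideanSpace ℂ (Fin a))‖) :
    LinearMap.toMatrix' L ∈ unitaryGroup (Fin a) ℂ := by
  let f : EuclideanSpace ℂ (Fin a) →ₗᵢ[ℂ] EuclideanSpace ℂ (Fin a) :=
    { toFun := fun x => WithLp.toLp 2 (L x.ofLp)
      map_add' := fun x y => by rw [WithLp.ofLp_add, map_add, WithLp.toLp_add]
      map_smul' := fun c x => by rw [WithLp.ofLp_smul, map_smul, WithLp.toLp_smul]; rfl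
      norm_map' := fun x => hL x.ofLp }
  rw [mem_unitaryGroup_iff', star_eq_conjTranspose]
  ext i j
  have h := f.inner_map_map (WithLp.toLp 2 (Pi.single i 1)) (WithLp.toLp 2 (Pi.single j 1))
  rw [PiLp.inner_apply, PiLp.inner_apply] at h
  rw [mul_apply, one_apply]
  simp only [conjTranspose_apply, LinearMap.toMatrix'_apply]
  convert h using 1
  · refine Finset.sum_congr rfl fun l _ => ?_
    rw [RCLike.inner_apply, mul_comm]
    simp [f]
  · simp [Pi.single_apply, eq_comm]

/-- A preserver that straightens all directions is undone by a product of local unitaries. -/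
theorem exists_isElementary_mul_eq_one (hΨ : IsLowPreserver k Ψ) (hk : 1 ≤ k)
    (hkmn : k < min m n)
    (he : ∀ i, ‖(WithLp.toLp 2 (e i) : EuclideanSpace ℂ (Fin (legDim m n i)))‖ = 1)
    (hσ : HasDirections Ψ e fun i => i) :
    ∃ g, IsElementary k m n g ∧ ∀ z, g (Ψ z) = z := by
  have he0 : ∀ i, e i ≠ 0 := fun i h0 => by
    have := he i
    rw [h0] at this
    simp at this
  obtain ⟨r', hr'⟩ := hΨ.exists_tensor hk hkmn e
  have hnorm : ∀ v, ‖toHilbert m n (Ψ (tensor m n v))‖ = ‖toHilbert m n (tensor m n v)‖ :=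
    fun v => hΨ.norm_map _ (lowOp_mono hk (mem_lowOp_one_iff.2 ⟨v, rfl⟩))
  -- The norms of the factors of `r'` have product 1, so normalizing each factor leaves the tensor
  -- unchanged.
  obtain ⟨r, hr, hr1⟩ : ∃ r, Ψ (tensor m n e) = tensor m n r ∧
      ∀ i, ‖(WithLp.toLp 2 (r i) : EuclideanSpace ℂ (Fin (legDim m n i)))‖ = 1 := by
    have hr0 := ne_zero_of_map_tensor hΨ.injective he0 hr'
    let N := fun i => ‖(WithLp.toLp 2 (r' i) : EuclideanSpace ℂ (Fin (legDim m n i)))‖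
    have hN0 : ∀ i, N i ≠ 0 := fun i h0 => hr0 i (by
      have := norm_eq_zero.1 h0
      simpa using this)
    have hN : ∏ i, N i = 1 := by
      rw [← norm_tensor, ← hr', hnorm, norm_tensor, Finset.prod_eq_one fun i _ => he i]
    refine ⟨fun i => (N i : ℂ)⁻¹ • r' i, ?_, fun i => ?_⟩
    · rw [MultilinearMap.map_smul_univ, Finset.prod_inv_distrib, ← Complex.ofReal_prod, hN, hr',
        Complex.ofReal_one, inv_one, one_smul]
    · rw [WithLp.toLp_smul, norm_smul, norm_inv, Complex.norm_real]
      change ‖N i‖⁻¹ * N i = 1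
      rw [norm_norm]
      exact inv_mul_cancel₀ (hN0 i)
  have hr0 := ne_zero_of_map_tensor hΨ.injective he0 hr
  choose L hL using hσ.exists_linearMap hΨ.injective he0 hr
  have hupd : ∀ {v : ∀ i, Leg m n i},
      (∀ i, ‖(WithLp.toLp 2 (v i) : EuclideanSpace ℂ (Fin (legDim m n i)))‖ = 1) → ∀ i u,
      ‖toHilbert m n (tensor m n (update v i u))‖ =
        ‖(WithLp.toLp 2 u : EuclideanSpace ℂ (Fin (legDim m n i)))‖ := by
    intro v hv i u
    rw [norm_tensor, Finset.prod_eq_single i, update_self]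
    · intro j _ hj
      rw [update_of_ne hj, hv]
    · simp
  -- All factors but the moved one are unit vectors, so norm preservation on tensors becomes norm
  -- preservation by `L i`.
  have hLnorm : ∀ i u, ‖(WithLp.toLp 2 (L i u) : EuclideanSpace ℂ (Fin (legDim m n i)))‖ =
      ‖(WithLp.toLp 2 u : EuclideanSpace ℂ (Fin (legDim m n i)))‖ := by
    intro i u
    rw [← hupd hr1, ← hL, hnorm, hupd he]
  have hLe : ∀ i, L i (e i) = r i := by
    intro i
    have h1 := hL i (e i)
    rw [update_eq_self, hr] at h1
    refine sub_eq_zero.1 (isSegre_tensor.eq_zero_of_update hr0 (j := i) ?_)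
    rw [MultilinearMap.map_update_sub, update_eq_self, ← h1, sub_self]
  let W := fun i => LinearMap.toMatrix' (L i)
  have hW : ∀ i, W i ∈ unitaryGroup (Fin (legDim m n i)) ℂ :=
    fun i => toMatrix'_mem_unitaryGroup (hLnorm i)
  have hWL : ∀ i u, (W i)ᴴ *ᵥ L i u = u := by
    intro i u
    have h1 := mem_unitaryGroup_iff'.1 (hW i)
    rw [star_eq_conjTranspose] at h1
    rw [← LinearMap.toMatrix'_mulVec (L i) u, mulVec_mulVec, h1, one_mulVec]
  let A : Matrix (Fin m) (Fin m) ℂ := (W (false, false))ᴴ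
  let B : Matrix (Fin n) (Fin n) ℂ := (W (false, true))ᴴ
  let C : Matrix (Fin m) (Fin m) ℂ := (W (true, false))ᴴ
  let D : Matrix (Fin n) (Fin n) ℂ := (W (true, true))ᴴ
  have hA : A ∈ unitaryGroup (Fin m) ℂ := conjTranspose_mem_unitaryGroup (hW (false, false))
  have hB : B ∈ unitaryGroup (Fin n) ℂ := conjTranspose_mem_unitaryGroup (hW (false, true))
  have hC : C ∈ unitaryGroup (Fin m) ℂ := conjTranspose_mem_unitaryGroup (hW (true, false))
  have hD : D ∈ unitaryGroup (Fin n) ℂ := conjTranspose_mem_unitaryGroup (hW (true, true))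
  have hg : IsElementary k m n (mulLeftRight (A ⊗ₖ B) (Cᵀ ⊗ₖ Dᵀ)) :=
    .mul _ _ (Or.inl ⟨A, hA, B, hB, rfl⟩) (Or.inl ⟨_, transpose_mem_unitaryGroup hC, _,
      transpose_mem_unitaryGroup hD, rfl⟩)
  refine ⟨_, hg, fun z => ?_⟩
  have hgΨ := hΨ.mul hg.isLowUnitary
  rw [← Module.End.mul_apply]
  refine ext_of_tensor (isSegre_tensor.map_eq_self_of_fixesStar hgΨ.injective
    (hgΨ.exists_tensor hk hkmn) he0 fun i u => ?_) z
  rw [Module.End.mul_apply, hL, mulLeftRight_tensor]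
  have hall : ∀ l, (W l)ᴴ *ᵥ update r i (L i u) l = update e i u l := by
    intro l
    rcases eq_or_ne l i with rfl | hl
    · rw [update_self, update_self, hWL]
    · rw [update_of_ne hl, update_of_ne hl, ← hLe, hWL]
  congr 1
  funext l
  rcases l with ⟨_ | _, _ | _⟩
  exacts [hall (false, false), hall (false, true), hall (true, false), hall (true, true)]

theorem exists_unit_and_not_parallel {a : ℕ} (ha : 2 ≤ a) : ∃ x : Fin a → ℂ,
    ‖(WithLp.toLp 2 x : EuclideanSpace ℂ (Fin a))‖ = 1 ∧ ∃ f, ¬∃ c : ℂ, f = c • x := by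
  refine ⟨Pi.single ⟨0, by omega⟩ 1, ?_, Pi.single ⟨1, by omega⟩ 1, ?_⟩
  · rw [EuclideanSpace.norm_eq]
    simp [Pi.single_apply, apply_ite norm, ite_pow]
  · rintro ⟨c, hc⟩
    have := congrFun hc ⟨1, by omega⟩
    simp at this

theorem isCompositionOfElementary_of_isometry (hk : 1 ≤ k) (hkmn : k < min m n)
    {Φ : Module.End ℂ (BipartiteOp m n)} (hΦ : ∀ X, schmidtOpNorm k (Φ X) = schmidtOpNorm k X) :
    IsCompositionOfElementary k m n Φ := by
  obtain ⟨Ψ, hadj, hinj, hmem, hnorm⟩ := exists_adjoint_of_isometry hk hΦ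
  have hΨ : IsLowPreserver k Ψ := ⟨hinj, hmem, hnorm⟩
  have hdim : ∀ i, 2 ≤ legDim m n i := by
    rintro ⟨_, _ | _⟩
    · change 2 ≤ m
      omega
    · change 2 ≤ n
      omega
  choose e he hf using fun i => exists_unit_and_not_parallel (hdim i)
  have he0 : ∀ i, e i ≠ 0 := fun i h0 => by
    have := he i
    rw [h0] at this
    simp at this
  obtain ⟨g, hg, hd⟩ := hΨ.isAlignable hk hkmn he0 hf
  have hgΨ := hΨ.mul (isLowUnitary_of_isCompositionOfElementary hg)
  obtain ⟨g', hg', hone⟩ := exists_isElementary_mul_eq_one hgΨ hk hkmn he hd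
  have hG : IsCompositionOfElementary k m n (g' * g) :=
    mul_mem (Subsemigroup.subset_closure hg') hg
  have hGu := isLowUnitary_of_isCompositionOfElementary hG
  -- With `G = g' * g`: `⟨z, Φ X⟩ = ⟨Ψ z, X⟩ = ⟨G (Ψ z), G X⟩ = ⟨z, G X⟩`.
  have hΦG : Φ = g' * g := by
    refine LinearMap.ext fun X => (toHilbert m n).injective (ext_inner_left ℂ fun x => ?_)
    obtain ⟨z, rfl⟩ := (toHilbert m n).surjective x
    change hsInner z (Φ X) = hsInner z ((g' * g) X)
    rw [← hadj, ← hGu.hsInner_map]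
    congr 1
    exact hone z
  rwa [hΦG]

end SchmidtIsometry

theorem theorem5p2 (k m n : ℕ) (hk : 1 ≤ k) (hkmn : k < min m n)
    (Φ : SchmidtIsometry.BipartiteOp m n →ₗ[ℂ] SchmidtIsometry.BipartiteOp m n) :
    (∀ X : SchmidtIsometry.BipartiteOp m n,
        SchmidtIsometry.schmidtOpNorm k (Φ X) = SchmidtIsometry.schmidtOpNorm k X) ↔
      SchmidtIsometry.IsCompositionOfElementary k m n Φ :=
  ⟨SchmidtIsometry.isCompositionOfElementary_of_isometry hk hkmn, fun h =>
    (SchmidtIsometry.isLowUnitary_of_isCompositionOfElementary h).schmidtOpNorm_map⟩
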